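/- Let $k$ be a field of characteristic zero. A dg operad $\mathcal O$ over $k$ is a symmetric, not necessarily unital operad in $\mathbb Z/2$-graded dg vector spaces over $k$: it consists of dg vector spaces $\mathcal O(n)$, $n=0,1,2,\dots$, with actions of the symmetric groups $S_n$ and partial compositions $\circ_i:\mathcal O(a)\otimes\mathcal O(b)\to\mathcal O(a+b-1)$, $1\le i\le a$, subject to the usual equivariance and associativity axioms and compatible with the differentials. Let $\mathcal O[m]$ be the dg operad obtained from $\mathcal O$ by freely adjoining an odd operation $m\in\mathcal O[m](1)$, with the differential that extends the one of $\mathcal O$ and satisfies $d(m)=-m^2$, where $m^2=m\circ_1 m$. Then $m$ is a Maurer–Cartan element, i.e. $dm+\tfrac12[m,m]=0$. Let $\hat{\mathcal O}=(\mathcal O[m])^m$ be the twisting of $\mathcal O[m]$ by $m$, i.e. the same operad with the differential $$d^m(z)=d(z)+m\circ_1 z-(-1)^{|z|}\sum_{i=1}^n z\circ_i m,\qquad z\in\mathcal O[m](n).$$ **Theorem 5.6.** For every dg operad $\mathcal O$: 1. the canonical map $\mathcal O\hookrightarrow\mathcal O[m]$ is an inclusion of dg operads and a quasi-isomorphism,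 i.e. it is injective and induces isomorphisms on the homology of $\mathcal O(n)\to\mathcal O[m](n)$ for all $n\ge 0$; 2. $\hat{\mathcal O}$ is acyclic, i.e. the homology of $\hat{\mathcal O}(n)$ vanishes for all $n\ge 0$. -/

import Mathlib

universe u v w

/-! # Symmetric operads in super vector spaces

Everything is `ℤ/2`-graded over a field `k`. Arities are natural numbers (arity `0` is allowed),
operads are symmetric, non-unital, and are given by partial compositions `∘_i`.

To avoid transports along equalities of arities and of parities, the operations take the arity and
the parity of their result as arguments, together with a proof that these are the right ones. -/

/-- The sign `(-1)^p` attached to a parity `p`. -/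
def paritySign (k : Type u) [Field k] (p : ZMod 2) : k := (-1) ^ p.val

/-- The relabelling of inputs in a partial composition `x ∘_i y`, where `x` has `a` inputs, `y` has
`b` inputs and the result has `c = a + b - 1` inputs: the inputs `j < i` of `x` keep their
position, the inputs of `y` take the positions `i, …, i + b - 1`, and the inputs `j > i` of `x` are
shifted by `b - 1`. -/
def insertEquiv {a b c : ℕ} (h : a + b = c + 1) (i : Fin a) :
    {j : Fin a // j ≠ i} ⊕ Fin b ≃ Fin c where
  toFun := Sum.elim
    (fun j => ⟨if j.1.1 < i.1 then j.1.1 else j.1.1 + b - 1, by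
      have h₁ := j.1.2
      have h₂ := Fin.val_ne_of_ne j.2
      split_ifs <;> omega⟩)
    (fun l => ⟨i.1 + l.1, by omega⟩)
  invFun t :=
    if h₁ : t.1 < i.1 then Sum.inl ⟨⟨t.1, by omega⟩, Fin.ne_of_val_ne (by simp only; omega)⟩
    else if h₂ : t.1 < i.1 + b then Sum.inr ⟨t.1 - i.1, by omega⟩
    else Sum.inl ⟨⟨t.1 + 1 - b, by omega⟩, Fin.ne_of_val_ne (by simp only; omega)⟩
  left_inv := by
    rintro (⟨j, hj⟩ | l)
    · have hj' := Fin.val_ne_of_ne hj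
      by_cases hlt : j.1 < i.1
      · simp only [Sum.elim_inl, hlt, if_true, dite_true]
      · have h₁ : ¬ (j.1 + b - 1 < i.1) := by omega
        have h₂ : ¬ (j.1 + b - 1 < i.1 + b) := by omega
        have h₃ : j.1 + b - 1 + 1 - b = j.1 := by omega
        simp only [Sum.elim_inl, hlt, if_false, h₁, h₂, dite_false, h₃]
    · simp
  right_inv := by
    intro t
    by_cases h₁ : t.1 < i.1
    · simp only [h₁, dite_true, Sum.elim_inl, if_true]
    · by_cases h₂ : t.1 < i.1 + b
      · simp only [h₁, h₂, dite_true, dite_false, Sum.elim_inr]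
        ext
        simp only
        omega
      · have h₃ : ¬ (t.1 + 1 - b < i.1) := by omega
        simp only [h₁, h₂, dite_false, Sum.elim_inl, h₃, if_false]
        ext
        simp only
        omega

/-- The permutation `σ ∘_i τ` of the inputs of `x ∘_i y` induced by a permutation `σ` of the inputs
of `x` and a permutation `τ` of the inputs of `y`; it goes from the labelling of `x ∘_i y` to that
of `(σ x) ∘_{σ i} (τ y)`. -/
def blockPerm {a b c : ℕ} (h : a + b = c + 1) (i : Fin a) (σ : Equiv.Perm (Fin a))
    (τ : Equiv.Perm (Fin b)) : Equiv.Perm (Fin c) :=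
  (insertEquiv h i).symm.trans
    ((Equiv.sumCongr (σ.subtypeEquiv (fun _ => not_congr σ.injective.eq_iff.symm)) τ).trans
      (insertEquiv h (σ i)))

/-- A (symmetric, non-unital) operad in super vector spaces over `k`: the space of operations of
arity `n` is the `ℤ/2`-graded space with components `Op n 0` and `Op n 1`. -/
structure SuperOperad (k : Type u) [Field k] where
  /-- the space of operations of given arity and parity -/
  Op : ℕ → ZMod 2 → Type v
  [addCommGroup : ∀ n p, AddCommGroup (Op n p)]
  [module : ∀ n p, Module k (Op n p)]
  /-- the (left) action of the symmetric groups; `σ x` is `x` with its input `j` renamed `σ j` -/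
  act : ∀ {n : ℕ} {p : ZMod 2}, Representation k (Equiv.Perm (Fin n)) (Op n p)
  /-- the partial composition `x ∘_i y` -/
  comp : ∀ {a b c : ℕ} {p q s : ZMod 2} (_ : Fin a) (_ : a + b = c + 1) (_ : p + q = s),
    Op a p →ₗ[k] Op b q →ₗ[k] Op c s
  comp_act : ∀ {a b c : ℕ} {p q s : ZMod 2} (i : Fin a) (hc : a + b = c + 1) (hs : p + q = s)
    (σ : Equiv.Perm (Fin a)) (τ : Equiv.Perm (Fin b)) (x : Op a p) (y : Op b q),
    comp (σ i) hc hs (act σ x) (act τ y) = act (blockPerm hc i σ τ) (comp i hc hs x y)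
  /-- `(x ∘_i y) ∘_j z = x ∘_i (y ∘_j z)` for an input `j` of `y` -/
  comp_seq : ∀ {a b c ab bc r : ℕ} {p q s pq qs t : ZMod 2} (i : Fin a) (j : Fin b)
    (h₁ : a + b = ab + 1) (h₂ : ab + c = r + 1) (h₃ : b + c = bc + 1) (h₄ : a + bc = r + 1)
    (e₁ : p + q = pq) (e₂ : pq + s = t) (e₃ : q + s = qs) (e₄ : p + qs = t)
    (x : Op a p) (y : Op b q) (z : Op c s),
    comp (insertEquiv h₁ i (Sum.inr j)) h₂ e₂ (comp i h₁ e₁ x y) z =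
      comp i h₄ e₄ x (comp j h₃ e₃ y z)
  /-- `(x ∘_i y) ∘_j z = (-1)^{|y||z|} (x ∘_j z) ∘_i y` for two different inputs `i, j` of `x` -/
  comp_par : ∀ {a b c ab ac r : ℕ} {p q s pq ps t : ZMod 2} (i j : Fin a) (hij : j ≠ i)
    (h₁ : a + b = ab + 1) (h₂ : ab + c = r + 1) (h₃ : a + c = ac + 1) (h₄ : ac + b = r + 1)
    (e₁ : p + q = pq) (e₂ : pq + s = t) (e₃ : p + s = ps) (e₄ : ps + q = t)
    (x : Op a p) (y : Op b q) (z : Op c s),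
    comp (insertEquiv h₁ i (Sum.inl ⟨j, hij⟩)) h₂ e₂ (comp i h₁ e₁ x y) z =
      paritySign k (q * s) •
        comp (insertEquiv h₃ j (Sum.inl ⟨i, hij.symm⟩)) h₄ e₄ (comp j h₃ e₃ x z) y

attribute [instance] SuperOperad.addCommGroup SuperOperad.module

/-- A dg operad: an operad in super vector spaces with an odd differential, compatible with the
actions of the symmetric groups, and a derivation for all partial compositions. -/
structure DGOperad (k : Type u) [Field k] extends SuperOperad.{u, v} k where
  /-- the differential -/
  d : ∀ {n : ℕ} {p q : ZMod 2} (_ : p + 1 = q), Op n p →ₗ[k] Op n q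
  d_d : ∀ {n : ℕ} {p q s : ZMod 2} (h : p + 1 = q) (h' : q + 1 = s) (x : Op n p),
    d h' (d h x) = 0
  d_act : ∀ {n : ℕ} {p q : ZMod 2} (h : p + 1 = q) (σ : Equiv.Perm (Fin n)) (x : Op n p),
    d h (act σ x) = act σ (d h x)
  /-- `d (x ∘_i y) = (d x) ∘_i y + (-1)^{|x|} x ∘_i (d y)` -/
  d_comp : ∀ {a b c : ℕ} {p p' q q' s t : ZMod 2} (i : Fin a) (hc : a + b = c + 1)
    (hs : p + q = s) (ht : s + 1 = t) (hp : p + 1 = p') (hp' : p' + q = t) (hq : q + 1 = q')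
    (hq' : p + q' = t) (x : Op a p) (y : Op b q),
    d ht (comp i hc hs x y) =
      comp i hc hp' (d hp x) y + paritySign k p • comp i hc hq' x (d hq y)

theorem parity_add_one_add_one (p : ZMod 2) : p + 1 + 1 = p := by
  rw [add_assoc, CharTwo.add_self_eq_zero, add_zero]

namespace DGOperad

variable {k : Type u} [Field k]

/-! ### Homology, morphisms, quasi-isomorphisms -/

/-- The cycles of arity `n` and parity `p`. -/
def cycles (O : DGOperad.{u, v} k) (n : ℕ) (p : ZMod 2) : Submodule k (O.Op n p) :=
  LinearMap.ker (O.d (rfl : p + 1 = p + 1))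

/-- The boundaries of arity `n` and parity `p`. -/
def boundaries (O : DGOperad.{u, v} k) (n : ℕ) (p : ZMod 2) : Submodule k (O.Op n p) :=
  LinearMap.range (O.d (parity_add_one_add_one p))

/-- The homology of the dg vector space `O(n)` in parity `p`. -/
abbrev Homology (O : DGOperad.{u, v} k) (n : ℕ) (p : ZMod 2) : Type v :=
  O.cycles n p ⧸ (O.boundaries n p).submoduleOf (O.cycles n p)

/-- A dg operad is acyclic if all the dg vector spaces `O(n)` have zero homology. -/
def IsAcyclic (O : DGOperad.{u, v} k) : Prop :=
  ∀ (n : ℕ) (p : ZMod 2), Subsingleton (O.Homology n p)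

/-- A morphism of dg operads. -/
structure Hom (O : DGOperad.{u, v} k) (P : DGOperad.{u, w} k) where
  /-- the underlying linear maps -/
  app : ∀ {n : ℕ} {p : ZMod 2}, O.Op n p →ₗ[k] P.Op n p
  app_act : ∀ {n : ℕ} {p : ZMod 2} (σ : Equiv.Perm (Fin n)) (x : O.Op n p),
    app (O.act σ x) = P.act σ (app x)
  app_comp : ∀ {a b c : ℕ} {p q s : ZMod 2} (i : Fin a) (hc : a + b = c + 1) (hs : p + q = s)
    (x : O.Op a p) (y : O.Op b q), app (O.comp i hc hs x y) = P.comp i hc hs (app x) (app y)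
  app_d : ∀ {n : ℕ} {p q : ZMod 2} (h : p + 1 = q) (x : O.Op n p),
    app (O.d h x) = P.d h (app x)

namespace Hom

variable {O : DGOperad.{u, v} k} {P : DGOperad.{u, w} k}

/-- A morphism is an inclusion if it is injective in each arity and parity. -/
def IsInclusion (f : Hom O P) : Prop :=
  ∀ (n : ℕ) (p : ZMod 2), Function.Injective (f.app : O.Op n p →ₗ[k] P.Op n p)

/-- The map induced by a morphism on cycles. -/
def cyclesMap (f : Hom O P) (n : ℕ) (p : ZMod 2) : O.cycles n p →ₗ[k] P.cycles n p :=
  (f.app : O.Op n p →ₗ[k] P.Op n p).restrict (fun x hx => by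
    have hx' : O.d (rfl : p + 1 = p + 1) x = 0 := hx
    change P.d (rfl : p + 1 = p + 1) (f.app x) = 0
    rw [← f.app_d, hx', map_zero])

/-- The map induced by a morphism on homology. -/
def homologyMap (f : Hom O P) (n : ℕ) (p : ZMod 2) : O.Homology n p →ₗ[k] P.Homology n p :=
  Submodule.mapQ _ _ (f.cyclesMap n p) (by
    rintro ⟨x, hx⟩ ⟨y, hy⟩
    refine ⟨f.app y, ?_⟩
    rw [← f.app_d, hy]
    rfl)

/-- A morphism of dg operads is a quasi-isomorphism if it induces an isomorphism on the homology
of `O(n)` for each arity `n`. -/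
def IsQuasiIso (f : Hom O P) : Prop :=
  ∀ (n : ℕ) (p : ZMod 2), Function.Bijective (f.homologyMap n p)

end Hom

end DGOperad

/-! ### Signs and small facts on relabellings -/

theorem paritySign_zero (k : Type u) [Field k] : paritySign k 0 = 1 := by
  simp [paritySign]

theorem paritySign_one (k : Type u) [Field k] : paritySign k 1 = -1 := by
  simp [paritySign, ZMod.val_one]

theorem zmod_two_cases (p : ZMod 2) : p = 0 ∨ p = 1 := by
  revert p; decide

theorem paritySign_add (k : Type u) [Field k] (p q : ZMod 2) :
    paritySign k (p + q) = paritySign k p * paritySign k q := by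
  rcases zmod_two_cases p with rfl | rfl <;> rcases zmod_two_cases q with rfl | rfl <;>
    simp [paritySign_zero, paritySign_one, CharTwo.add_self_eq_zero]

theorem paritySign_mul_self (k : Type u) [Field k] (p : ZMod 2) :
    paritySign k p * paritySign k p = 1 := by
  rw [← paritySign_add, CharTwo.add_self_eq_zero, paritySign_zero]

theorem insertEquiv_one_left {b : ℕ} (h : 1 + b = b + 1) (l : Fin b) :
    insertEquiv h 0 (Sum.inr l) = l := by
  ext; simp [insertEquiv]

theorem insertEquiv_one_right_inl {a : ℕ} (h : a + 1 = a + 1) (i : Fin a)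
    (j : {j : Fin a // j ≠ i}) : insertEquiv h i (Sum.inl j) = j.1 := by
  ext; simp [insertEquiv]

theorem insertEquiv_one_right_inr {a : ℕ} (h : a + 1 = a + 1) (i : Fin a) (l : Fin 1) :
    insertEquiv h i (Sum.inr l) = i := by
  ext; simp [insertEquiv]

theorem blockPerm_apply {a b c : ℕ} (h : a + b = c + 1) (i : Fin a) (σ : Equiv.Perm (Fin a))
    (τ : Equiv.Perm (Fin b)) (t : {j : Fin a // j ≠ i} ⊕ Fin b) :
    blockPerm h i σ τ (insertEquiv h i t) =
      insertEquiv h (σ i) (Sum.map (fun j => ⟨σ j.1, fun e => j.2 (σ.injective e)⟩) τ t) := by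
  rcases t with t | t <;> simp [blockPerm, Equiv.subtypeEquiv]

theorem blockPerm_one_right {a : ℕ} (h : a + 1 = a + 1) (i : Fin a) (σ : Equiv.Perm (Fin a)) :
    blockPerm h i σ 1 = σ := by
  ext1 t
  obtain ⟨t, rfl⟩ := (insertEquiv h i).surjective t
  rw [blockPerm_apply]
  rcases t with t | t
  · simp only [Sum.map_inl, insertEquiv_one_right_inl]
  · simp only [Sum.map_inr, insertEquiv_one_right_inr]

theorem blockPerm_one_left {b : ℕ} (h : 1 + b = b + 1) (σ : Equiv.Perm (Fin 1))
    (τ : Equiv.Perm (Fin b)) : blockPerm h 0 σ τ = τ := by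
  obtain rfl : σ = 1 := Subsingleton.elim _ _
  ext1 t
  obtain ⟨t, rfl⟩ := (insertEquiv h 0).surjective t
  rw [blockPerm_apply]
  rcases t with t | t
  · exact absurd (Subsingleton.elim _ _) t.2
  · rw [insertEquiv_one_left]
    exact insertEquiv_one_left h (τ t)

theorem one_add_one_parity : (1 : ZMod 2) + 1 = 0 := rfl

/-! ### Twisting by a Maurer-Cartan element -/

namespace SuperOperad

variable {k : Type u} [Field k] (O : SuperOperad.{u, v} k)

/-- The operator `z ↦ a ∘_1 z` for a unary operation `a`. -/
def leftMul {n : ℕ} {p q s : ZMod 2} (hs : p + q = s) (a : O.Op 1 p) : O.Op n q →ₗ[k] O.Op n s :=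
  O.comp 0 (Nat.add_comm 1 n) hs a

/-- The operator `z ↦ ∑_i z ∘_i a` for a unary operation `a`. -/
def rightMul {n : ℕ} {p q s : ZMod 2} (hs : p + q = s) (a : O.Op 1 p) : O.Op n q →ₗ[k] O.Op n s :=
  ∑ i : Fin n, (O.comp i rfl ((add_comm q p).trans hs)).flip a

/-- The inner derivation `δ_a(z) = a ∘_1 z - (-1)^{|a||z|} ∑_i z ∘_i a` of an operad given by a
unary operation `a`. -/
def inner {n : ℕ} {p q s : ZMod 2} (hs : p + q = s) (a : O.Op 1 p) : O.Op n q →ₗ[k] O.Op n s :=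
  O.leftMul hs a - paritySign k (p * q) • O.rightMul hs a

/-- The commutator `[a, b] = a ∘_1 b - (-1)^{|a||b|} b ∘_1 a` of unary operations. -/
def bracket {p q s : ZMod 2} (hs : p + q = s) (a : O.Op 1 p) (b : O.Op 1 q) : O.Op 1 s :=
  O.comp 0 rfl hs a b - paritySign k (p * q) • O.comp 0 rfl ((add_comm q p).trans hs) b a

variable {O}

theorem rightMul_apply {n : ℕ} {p q s : ZMod 2} (hs : p + q = s) (a : O.Op 1 p) (z : O.Op n q) :
    O.rightMul hs a z = ∑ i : Fin n, O.comp i rfl ((add_comm q p).trans hs) z a := by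
  simp [rightMul]

theorem leftMul_act {n : ℕ} {p q s : ZMod 2} (hs : p + q = s) (a : O.Op 1 p) (z : O.Op n q)
    (σ : Equiv.Perm (Fin n)) : O.leftMul hs a (O.act σ z) = O.act σ (O.leftMul hs a z) := by
  have h := O.comp_act 0 (Nat.add_comm 1 n) hs 1 σ a z
  rw [blockPerm_one_left, map_one] at h
  exact h

theorem rightMul_act {n : ℕ} {p q s : ZMod 2} (hs : p + q = s) (a : O.Op 1 p) (z : O.Op n q)
    (σ : Equiv.Perm (Fin n)) : O.rightMul hs a (O.act σ z) = O.act σ (O.rightMul hs a z) := by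
  rw [rightMul_apply, rightMul_apply, map_sum, ← Equiv.sum_comp σ]
  refine Finset.sum_congr rfl fun i _ => ?_
  have h := O.comp_act i rfl ((add_comm q p).trans hs) σ 1 z a
  rw [blockPerm_one_right, map_one] at h
  exact h

theorem leftMul_comp {a b c : ℕ} {r p p' q s t : ZMod 2} (m : O.Op 1 r) (i : Fin a)
    (hc : a + b = c + 1) (hs : p + q = s) (ht : r + s = t) (hp : r + p = p') (hp' : p' + q = t)
    (x : O.Op a p) (y : O.Op b q) :
    O.leftMul ht m (O.comp i hc hs x y) = O.comp i hc hp' (O.leftMul hp m x) y := by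
  have h := O.comp_seq (0 : Fin 1) i (Nat.add_comm 1 a) hc hc (Nat.add_comm 1 c) hp hp' hs ht m x y
  rw [insertEquiv_one_left] at h
  exact h.symm

theorem comp_comp_self {a b c : ℕ} {r p p' q q' t : ZMod 2} (m : O.Op 1 r) (i : Fin a)
    (hc : a + b = c + 1) (hp : p + r = p') (hp' : p' + q = t) (hq : r + q = q') (hq' : p + q' = t)
    (x : O.Op a p) (y : O.Op b q) :
    O.comp i hc hp' (O.comp i rfl hp x m) y = O.comp i hc hq' x (O.leftMul hq m y) := by
  have h := O.comp_seq i (0 : Fin 1) rfl hc (Nat.add_comm 1 b) hc hp hp' hq hq' x m y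
  rw [insertEquiv_one_right_inr] at h
  exact h

theorem rightMul_comp {a b c : ℕ} {r p p' q q' s t : ZMod 2} (m : O.Op 1 r) (i : Fin a)
    (hc : a + b = c + 1) (hs : p + q = s) (ht : r + s = t) (hp : r + p = p') (hp' : p' + q = t)
    (hq : r + q = q') (hq' : p + q' = t) (x : O.Op a p) (y : O.Op b q) :
    O.rightMul ht m (O.comp i hc hs x y) =
      paritySign k (q * r) • (O.comp i hc hp' (O.rightMul hp m x) y -
        O.comp i hc hq' x (O.leftMul hq m y)) + O.comp i hc hq' x (O.rightMul hq m y) := by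
  have e1 : s + r = t := (add_comm s r).trans ht
  have e2 : p + r = p' := (add_comm p r).trans hp
  have e3 : q + r = q' := (add_comm q r).trans hq
  have hL : ∀ j : {j : Fin a // j ≠ i},
      O.comp (insertEquiv hc i (Sum.inl j)) rfl e1 (O.comp i hc hs x y) m =
        paritySign k (q * r) • O.comp i hc hp' (O.comp j.1 rfl e2 x m) y := by
    rintro ⟨j, hj⟩
    have h := O.comp_par i j hj hc rfl rfl hc hs e1 e2 hp' x y m
    rw [insertEquiv_one_right_inl] at h
    exact h
  have hR : ∀ l : Fin b,
      O.comp (insertEquiv hc i (Sum.inr l)) rfl e1 (O.comp i hc hs x y) m =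
        O.comp i hc hq' x (O.comp l rfl e3 y m) := fun l =>
    O.comp_seq i l hc rfl rfl hc hs e1 e3 hq' x y m
  have hsum : ∑ j : {j : Fin a // j ≠ i}, O.comp i hc hp' (O.comp j.1 rfl e2 x m) y =
      O.comp i hc hp' (O.rightMul hp m x) y - O.comp i hc hq' x (O.leftMul hq m y) := by
    rw [← comp_comp_self m i hc e2 hp' hq hq' x y, rightMul_apply, map_sum, LinearMap.sum_apply,
      eq_sub_iff_add_eq, add_comm]
    exact (Fintype.sum_eq_add_sum_subtype_ne
      (fun j => O.comp i hc hp' (O.comp j rfl e2 x m) y) i).symm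
  rw [rightMul_apply, ← Equiv.sum_comp (insertEquiv hc i), Fintype.sum_sum_type]
  simp only [hL, hR]
  rw [← Finset.smul_sum, hsum, rightMul_apply hq m y, map_sum]

theorem inner_apply {n : ℕ} {p q s : ZMod 2} (hs : p + q = s) (a : O.Op 1 p) (z : O.Op n q) :
    O.inner hs a z = O.leftMul hs a z - paritySign k (p * q) • O.rightMul hs a z := rfl

theorem inner_add {n : ℕ} {p q s : ZMod 2} (hs : p + q = s) (a b : O.Op 1 p) (z : O.Op n q) :
    O.inner hs (a + b) z = O.inner hs a z + O.inner hs b z := by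
  simp only [inner_apply, leftMul, rightMul_apply, map_add, LinearMap.add_apply,
    Finset.sum_add_distrib, smul_add]
  abel

theorem inner_zero {n : ℕ} {p q s : ZMod 2} (hs : p + q = s) (z : O.Op n q) :
    O.inner hs (0 : O.Op 1 p) z = 0 := by
  simp [inner_apply, leftMul, rightMul_apply]

theorem inner_act {n : ℕ} {p q s : ZMod 2} (hs : p + q = s) (a : O.Op 1 p) (z : O.Op n q)
    (σ : Equiv.Perm (Fin n)) : O.inner hs a (O.act σ z) = O.act σ (O.inner hs a z) := by
  simp [inner, leftMul_act, rightMul_act]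

/-- The operator `δ_m` is a derivation. -/
theorem inner_comp {a b c : ℕ} {p p' q q' s t : ZMod 2} (m : O.Op 1 1) (i : Fin a)
    (hc : a + b = c + 1) (hs : p + q = s) (ht : 1 + s = t) (hp : 1 + p = p') (hp' : p' + q = t)
    (hq : 1 + q = q') (hq' : p + q' = t) (x : O.Op a p) (y : O.Op b q) :
    O.inner ht m (O.comp i hc hs x y) = O.comp i hc hp' (O.inner hp m x) y +
      paritySign k p • O.comp i hc hq' x (O.inner hq m y) := by
  have hsq := paritySign_mul_self k q
  simp only [inner, LinearMap.sub_apply, LinearMap.smul_apply, map_sub, map_smul, one_mul,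
    leftMul_comp m i hc hs ht hp hp' x y, rightMul_comp m i hc hs ht hp hp' hq hq' x y, mul_one,
    ← hs, paritySign_add, smul_add, smul_sub, smul_smul, mul_assoc, hsq]
  abel

theorem rightMul_rightMul [CharZero k] {n : ℕ} {q q' q'' : ZMod 2} (m : O.Op 1 1)
    (hq : 1 + q = q') (hq' : 1 + q' = q'') (h0 : (1 : ZMod 2) + 1 = 0) (hz : 0 + q = q'')
    (z : O.Op n q) :
    O.rightMul hq' m (O.rightMul hq m z) = O.rightMul hz (O.comp 0 rfl h0 m m) z := by
  have hq0 : q + 0 = q'' := (add_comm q 0).trans hz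
  have h1 : ∀ i : Fin n, O.rightMul hq' m (O.comp i rfl ((add_comm q 1).trans hq) z m) =
      -(O.comp i rfl ((add_comm q' 1).trans hq') (O.rightMul hq m z) m) +
        (2 : k) • O.comp i rfl hq0 z (O.comp 0 rfl h0 m m) := by
    intro i
    have hR : O.rightMul h0 m m = O.comp 0 rfl h0 m m := by
      rw [rightMul_apply]; exact Fin.sum_univ_one _
    rw [rightMul_comp m i rfl ((add_comm q 1).trans hq) hq' hq ((add_comm q' 1).trans hq') h0 hq0,
      hR, mul_one, paritySign_one, neg_one_smul, neg_sub, two_smul]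
    change O.comp i rfl hq0 z (O.comp 0 rfl h0 m m) - _ + _ = _
    abel
  have h2 : O.rightMul hq' m (O.rightMul hq m z) = -(O.rightMul hq' m (O.rightMul hq m z)) +
      (2 : k) • O.rightMul hz (O.comp 0 rfl h0 m m) z := by
    conv_lhs => rw [rightMul_apply hq, map_sum]
    simp only [h1]
    rw [Finset.sum_add_distrib, Finset.sum_neg_distrib, ← Finset.smul_sum, ← rightMul_apply hq',
      rightMul_apply hz]
  have h3 : (2 : k) • O.rightMul hq' m (O.rightMul hq m z) =
      (2 : k) • O.rightMul hz (O.comp 0 rfl h0 m m) z := by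
    rw [two_smul]
    nth_rewrite 1 [h2]
    abel
  exact smul_right_injective _ (two_ne_zero : (2 : k) ≠ 0) h3

theorem inner_inner [CharZero k] {n : ℕ} {q q' q'' : ZMod 2} (m : O.Op 1 1)
    (hq : 1 + q = q') (hq' : 1 + q' = q'') (h0 : (1 : ZMod 2) + 1 = 0) (hz : 0 + q = q'')
    (z : O.Op n q) :
    O.inner hq' m (O.inner hq m z) = O.inner hz (O.comp 0 rfl h0 m m) z := by
  have hLL : O.leftMul hq' m (O.leftMul hq m z) = O.leftMul hz (O.comp 0 rfl h0 m m) z :=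
    leftMul_comp m 0 (Nat.add_comm 1 n) hq hq' h0 hz m z
  have hLR : O.leftMul hq' m (O.rightMul hq m z) = O.rightMul hq' m (O.leftMul hq m z) := by
    rw [rightMul_apply, rightMul_apply, map_sum]
    exact Finset.sum_congr rfl fun i _ => leftMul_comp m i rfl _ _ _ _ z m
  simp only [inner_apply, map_sub, map_smul, one_mul,
    zero_mul, paritySign_zero, one_smul, hLL, hLR, rightMul_rightMul m hq hq' h0 hz z, ← hq,
    paritySign_add, paritySign_one, smul_sub, smul_smul, neg_mul, smul_neg,
    paritySign_mul_self, neg_smul]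
  abel

end SuperOperad

namespace DGOperad

variable {k : Type u} [Field k] (O : DGOperad.{u, v} k)

/-- An odd unary operation `m` is a Maurer-Cartan element if `d m + (1/2) [m, m] = 0`. -/
def IsMaurerCartan (m : O.Op 1 1) : Prop :=
  O.d one_add_one_parity m + (2⁻¹ : k) • O.bracket one_add_one_parity m m = 0

variable {O}

theorem IsMaurerCartan.d_add_comp [CharZero k] {m : O.Op 1 1} (hm : O.IsMaurerCartan m) :
    O.d one_add_one_parity m + O.comp 0 rfl one_add_one_parity m m = 0 := by
  have h2 : (2⁻¹ : k) * 2 = 1 := inv_mul_cancel₀ two_ne_zero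
  have h : O.bracket one_add_one_parity m m =
      (2 : k) • O.comp 0 rfl one_add_one_parity m m := by
    simp only [SuperOperad.bracket, mul_one, paritySign_one, two_smul, neg_smul, one_smul,
      sub_neg_eq_add]
  rw [IsMaurerCartan, h, smul_smul, h2, one_smul] at hm
  exact hm

theorem d_inner (m : O.Op 1 1) {n : ℕ} {q q' q'' : ZMod 2} (hq : q + 1 = q') (hq' : q' + 1 = q'')
    (hr : 1 + q = q') (hr' : 1 + q' = q'') (hz : 0 + q = q'') (z : O.Op n q) :
    O.d hq' (O.inner hr m z) =
      O.inner hz (O.d one_add_one_parity m) z - O.inner hr' m (O.d hq z) := by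
  have hL : O.d hq' (O.leftMul hr m z) =
      O.leftMul hz (O.d one_add_one_parity m) z - O.leftMul hr' m (O.d hq z) := by
    have h := O.d_comp 0 (Nat.add_comm 1 n) hr hq' one_add_one_parity hz hq hr' m z
    rw [paritySign_one, neg_one_smul, ← sub_eq_add_neg] at h
    exact h
  have hR : O.d hq' (O.rightMul hr m z) = O.rightMul hr' m (O.d hq z) +
      paritySign k q • O.rightMul hz (O.d one_add_one_parity m) z := by
    simp only [SuperOperad.rightMul_apply, map_sum, Finset.smul_sum, ← Finset.sum_add_distrib]
    exact Finset.sum_congr rfl fun i _ => O.d_comp i rfl _ hq' hq _ one_add_one_parity _ z m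
  simp only [SuperOperad.inner_apply, map_sub, map_smul, hL, hR, one_mul, zero_mul,
    paritySign_zero, one_smul, ← hq, paritySign_add, paritySign_one, smul_add, smul_smul,
    paritySign_mul_self, mul_neg, mul_one, neg_smul]
  abel

/-- The twisting `O^m` of a dg operad `O` by a Maurer-Cartan element `m`: the same operad, with
the differential `d + δ_m`. -/
def twist [CharZero k] (O : DGOperad.{u, v} k) (m : O.Op 1 1) (hm : O.IsMaurerCartan m) :
    DGOperad.{u, v} k where
  toSuperOperad := O.toSuperOperad
  d h := O.d h + O.inner ((add_comm _ _).trans h) m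
  d_d := by
    intro n p q s h h' x
    obtain rfl : p = s := by rw [← h', ← h, parity_add_one_add_one]
    simp only [LinearMap.add_apply, map_add, O.d_d, zero_add]
    rw [d_inner m h h' ((add_comm _ _).trans h) ((add_comm _ _).trans h') (zero_add p),
      SuperOperad.inner_inner m _ _ one_add_one_parity (zero_add p), ← add_assoc, ← add_sub_assoc,
      add_sub_cancel_left, ← SuperOperad.inner_add, hm.d_add_comp, SuperOperad.inner_zero]
  d_act := by
    intro n p q h σ x
    simp only [LinearMap.add_apply, map_add, O.d_act, SuperOperad.inner_act]
  d_comp := by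
    intro a b c p p' q q' s t i hc hs ht hp hp' hq hq' x y
    simp only [LinearMap.add_apply, map_add, smul_add, O.d_comp i hc hs ht hp hp' hq hq' x y,
      SuperOperad.inner_comp m i hc hs ((add_comm _ _).trans ht) ((add_comm _ _).trans hp) hp'
        ((add_comm _ _).trans hq) hq' x y]
    abel

end DGOperad


/-! ### Freely adjoining an odd unary operation -/

namespace SuperOperad

variable {k : Type u} [Field k]

/-- Formal expressions, of given arity and parity, in the operations of `O` and an additional odd
unary operation `m`, built with the operations of an operad in super vector spaces. -/
inductive AdjoinExpr (O : SuperOperad.{u, v} k) : ℕ → ZMod 2 → Type (max u v)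
  | of {n : ℕ} {p : ZMod 2} (x : O.Op n p) : AdjoinExpr O n p
  | m : AdjoinExpr O 1 1
  | zero {n : ℕ} {p : ZMod 2} : AdjoinExpr O n p
  | add {n : ℕ} {p : ZMod 2} (x y : AdjoinExpr O n p) : AdjoinExpr O n p
  | smul {n : ℕ} {p : ZMod 2} (r : k) (x : AdjoinExpr O n p) : AdjoinExpr O n p
  | act {n : ℕ} {p : ZMod 2} (σ : Equiv.Perm (Fin n)) (x : AdjoinExpr O n p) : AdjoinExpr O n p
  | comp {a b c : ℕ} {p q s : ZMod 2} (i : Fin a) (hc : a + b = c + 1) (hs : p + q = s)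
      (x : AdjoinExpr O a p) (y : AdjoinExpr O b q) : AdjoinExpr O c s

/-- The smallest congruence on formal expressions for which the quotient is an operad in super
vector spaces and receives a morphism of operads from `O`. (The symmetric group `S_1` acts
trivially on `m`, as it is trivial.) -/
inductive AdjoinRel (O : SuperOperad.{u, v} k) :
    ∀ {n : ℕ} {p : ZMod 2}, AdjoinExpr O n p → AdjoinExpr O n p → Prop
  -- equivalence relation
  | refl {n : ℕ} {p : ZMod 2} (x : AdjoinExpr O n p) : AdjoinRel O x x
  | symm {n : ℕ} {p : ZMod 2} {x y : AdjoinExpr O n p} : AdjoinRel O x y → AdjoinRel O y x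
  | trans {n : ℕ} {p : ZMod 2} {x y z : AdjoinExpr O n p} :
      AdjoinRel O x y → AdjoinRel O y z → AdjoinRel O x z
  -- compatibility with the operations
  | congr_add {n : ℕ} {p : ZMod 2} {x x' y y' : AdjoinExpr O n p} :
      AdjoinRel O x x' → AdjoinRel O y y' → AdjoinRel O (.add x y) (.add x' y')
  | congr_smul {n : ℕ} {p : ZMod 2} (r : k) {x x' : AdjoinExpr O n p} :
      AdjoinRel O x x' → AdjoinRel O (.smul r x) (.smul r x')
  | congr_act {n : ℕ} {p : ZMod 2} (σ : Equiv.Perm (Fin n)) {x x' : AdjoinExpr O n p} :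
      AdjoinRel O x x' → AdjoinRel O (.act σ x) (.act σ x')
  | congr_comp {a b c : ℕ} {p q s : ZMod 2} (i : Fin a) (hc : a + b = c + 1) (hs : p + q = s)
      {x x' : AdjoinExpr O a p} {y y' : AdjoinExpr O b q} :
      AdjoinRel O x x' → AdjoinRel O y y' →
        AdjoinRel O (.comp i hc hs x y) (.comp i hc hs x' y')
  -- vector spaces
  | add_assoc {n : ℕ} {p : ZMod 2} (x y z : AdjoinExpr O n p) :
      AdjoinRel O (.add (.add x y) z) (.add x (.add y z))
  | add_comm {n : ℕ} {p : ZMod 2} (x y : AdjoinExpr O n p) :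
      AdjoinRel O (.add x y) (.add y x)
  | zero_add {n : ℕ} {p : ZMod 2} (x : AdjoinExpr O n p) : AdjoinRel O (.add .zero x) x
  | zero_smul {n : ℕ} {p : ZMod 2} (x : AdjoinExpr O n p) : AdjoinRel O (.smul 0 x) .zero
  | one_smul {n : ℕ} {p : ZMod 2} (x : AdjoinExpr O n p) : AdjoinRel O (.smul 1 x) x
  | mul_smul {n : ℕ} {p : ZMod 2} (r r' : k) (x : AdjoinExpr O n p) :
      AdjoinRel O (.smul (r * r') x) (.smul r (.smul r' x))
  | add_smul {n : ℕ} {p : ZMod 2} (r r' : k) (x : AdjoinExpr O n p) :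
      AdjoinRel O (.smul (r + r') x) (.add (.smul r x) (.smul r' x))
  | smul_add {n : ℕ} {p : ZMod 2} (r : k) (x y : AdjoinExpr O n p) :
      AdjoinRel O (.smul r (.add x y)) (.add (.smul r x) (.smul r y))
  -- representations of the symmetric groups
  | act_add {n : ℕ} {p : ZMod 2} (σ : Equiv.Perm (Fin n)) (x y : AdjoinExpr O n p) :
      AdjoinRel O (.act σ (.add x y)) (.add (.act σ x) (.act σ y))
  | act_smul {n : ℕ} {p : ZMod 2} (σ : Equiv.Perm (Fin n)) (r : k) (x : AdjoinExpr O n p) :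
      AdjoinRel O (.act σ (.smul r x)) (.smul r (.act σ x))
  | act_one {n : ℕ} {p : ZMod 2} (x : AdjoinExpr O n p) : AdjoinRel O (.act 1 x) x
  | act_mul {n : ℕ} {p : ZMod 2} (σ τ : Equiv.Perm (Fin n)) (x : AdjoinExpr O n p) :
      AdjoinRel O (.act (σ * τ) x) (.act σ (.act τ x))
  -- bilinearity, equivariance and associativity of the partial compositions
  | comp_add_left {a b c : ℕ} {p q s : ZMod 2} (i : Fin a) (hc : a + b = c + 1) (hs : p + q = s)
      (x x' : AdjoinExpr O a p) (y : AdjoinExpr O b q) :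
      AdjoinRel O (.comp i hc hs (.add x x') y) (.add (.comp i hc hs x y) (.comp i hc hs x' y))
  | comp_smul_left {a b c : ℕ} {p q s : ZMod 2} (i : Fin a) (hc : a + b = c + 1) (hs : p + q = s)
      (r : k) (x : AdjoinExpr O a p) (y : AdjoinExpr O b q) :
      AdjoinRel O (.comp i hc hs (.smul r x) y) (.smul r (.comp i hc hs x y))
  | comp_add_right {a b c : ℕ} {p q s : ZMod 2} (i : Fin a) (hc : a + b = c + 1) (hs : p + q = s)
      (x : AdjoinExpr O a p) (y y' : AdjoinExpr O b q) :
      AdjoinRel O (.comp i hc hs x (.add y y')) (.add (.comp i hc hs x y) (.comp i hc hs x y'))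
  | comp_smul_right {a b c : ℕ} {p q s : ZMod 2} (i : Fin a) (hc : a + b = c + 1) (hs : p + q = s)
      (r : k) (x : AdjoinExpr O a p) (y : AdjoinExpr O b q) :
      AdjoinRel O (.comp i hc hs x (.smul r y)) (.smul r (.comp i hc hs x y))
  | comp_act {a b c : ℕ} {p q s : ZMod 2} (i : Fin a) (hc : a + b = c + 1) (hs : p + q = s)
      (σ : Equiv.Perm (Fin a)) (τ : Equiv.Perm (Fin b))
      (x : AdjoinExpr O a p) (y : AdjoinExpr O b q) :
      AdjoinRel O (.comp (σ i) hc hs (.act σ x) (.act τ y))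
        (.act (blockPerm hc i σ τ) (.comp i hc hs x y))
  | comp_seq {a b c ab bc r : ℕ} {p q s pq qs t : ZMod 2} (i : Fin a) (j : Fin b)
      (h₁ : a + b = ab + 1) (h₂ : ab + c = r + 1) (h₃ : b + c = bc + 1) (h₄ : a + bc = r + 1)
      (e₁ : p + q = pq) (e₂ : pq + s = t) (e₃ : q + s = qs) (e₄ : p + qs = t)
      (x : AdjoinExpr O a p) (y : AdjoinExpr O b q) (z : AdjoinExpr O c s) :
      AdjoinRel O (.comp (insertEquiv h₁ i (Sum.inr j)) h₂ e₂ (.comp i h₁ e₁ x y) z)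
        (.comp i h₄ e₄ x (.comp j h₃ e₃ y z))
  | comp_par {a b c ab ac r : ℕ} {p q s pq ps t : ZMod 2} (i j : Fin a) (hij : j ≠ i)
      (h₁ : a + b = ab + 1) (h₂ : ab + c = r + 1) (h₃ : a + c = ac + 1) (h₄ : ac + b = r + 1)
      (e₁ : p + q = pq) (e₂ : pq + s = t) (e₃ : p + s = ps) (e₄ : ps + q = t)
      (x : AdjoinExpr O a p) (y : AdjoinExpr O b q) (z : AdjoinExpr O c s) :
      AdjoinRel O (.comp (insertEquiv h₁ i (Sum.inl ⟨j, hij⟩)) h₂ e₂ (.comp i h₁ e₁ x y) z)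
        (.smul (paritySign k (q * s))
          (.comp (insertEquiv h₃ j (Sum.inl ⟨i, hij.symm⟩)) h₄ e₄ (.comp j h₃ e₃ x z) y))
  -- the map from `O` is a morphism of operads
  | of_add {n : ℕ} {p : ZMod 2} (x y : O.Op n p) :
      AdjoinRel O (.of (x + y)) (.add (.of x) (.of y))
  | of_smul {n : ℕ} {p : ZMod 2} (r : k) (x : O.Op n p) :
      AdjoinRel O (.of (r • x)) (.smul r (.of x))
  | of_act {n : ℕ} {p : ZMod 2} (σ : Equiv.Perm (Fin n)) (x : O.Op n p) :
      AdjoinRel O (.of (O.act σ x)) (.act σ (.of x))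
  | of_comp {a b c : ℕ} {p q s : ZMod 2} (i : Fin a) (hc : a + b = c + 1) (hs : p + q = s)
      (x : O.Op a p) (y : O.Op b q) :
      AdjoinRel O (.of (O.comp i hc hs x y)) (.comp i hc hs (.of x) (.of y))

/-- The congruence on formal expressions, as a setoid. -/
instance adjoinSetoid (O : SuperOperad.{u, v} k) (n : ℕ) (p : ZMod 2) :
    Setoid (AdjoinExpr O n p) where
  r x y := AdjoinRel O x y
  iseqv := ⟨.refl, .symm, .trans⟩

/-- The operations of `O[m]`. -/
def AdjoinOp (O : SuperOperad.{u, v} k) (n : ℕ) (p : ZMod 2) : Type (max u v) :=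
  Quotient (adjoinSetoid O n p)

namespace AdjoinOp

variable {O : SuperOperad.{u, v} k}

/-- The operation of `O[m]` given by a formal expression. -/
def mk {n : ℕ} {p : ZMod 2} (x : AdjoinExpr O n p) : AdjoinOp O n p :=
  Quotient.mk (adjoinSetoid O n p) x

theorem sound {n : ℕ} {p : ZMod 2} {x y : AdjoinExpr O n p} (h : AdjoinRel O x y) :
    mk x = mk y := Quotient.sound h

theorem ind {n : ℕ} {p : ZMod 2} {C : AdjoinOp O n p → Prop} (h : ∀ x, C (mk x)) (x) : C x :=
  Quotient.ind h x

instance {n : ℕ} {p : ZMod 2} : Zero (AdjoinOp O n p) := ⟨mk .zero⟩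

instance {n : ℕ} {p : ZMod 2} : Add (AdjoinOp O n p) :=
  ⟨Quotient.map₂ .add fun _ _ h _ _ h' => .congr_add h h'⟩

instance {n : ℕ} {p : ZMod 2} : SMul k (AdjoinOp O n p) :=
  ⟨fun r => Quotient.map (.smul r) fun _ _ h => .congr_smul r h⟩

instance {n : ℕ} {p : ZMod 2} : AddCommMonoid (AdjoinOp O n p) where
  add_assoc x y z := by
    induction x using ind; induction y using ind; induction z using ind
    exact sound (.add_assoc _ _ _)
  zero_add x := by
    induction x using ind
    exact sound (.zero_add _)
  add_zero x := by
    induction x using ind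
    exact sound (.trans (.add_comm _ _) (.zero_add _))
  add_comm x y := by
    induction x using ind; induction y using ind
    exact sound (.add_comm _ _)
  nsmul := nsmulRec

instance {n : ℕ} {p : ZMod 2} : Module k (AdjoinOp O n p) where
  one_smul x := by
    induction x using ind
    exact sound (.one_smul _)
  mul_smul r r' x := by
    induction x using ind
    exact sound (.mul_smul _ _ _)
  smul_add r x y := by
    induction x using ind; induction y using ind
    exact sound (.smul_add _ _ _)
  add_smul r r' x := by
    induction x using ind
    exact sound (.add_smul _ _ _)
  zero_smul x := by
    induction x using ind
    exact sound (.zero_smul _)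
  smul_zero r := by
    refine sound (.trans (.congr_smul r (.symm (.zero_smul .zero))) ?_)
    refine .trans (.symm (.mul_smul r 0 .zero)) ?_
    rw [mul_zero]
    exact .zero_smul _

instance {n : ℕ} {p : ZMod 2} : AddCommGroup (AdjoinOp O n p) :=
  Module.addCommMonoidToAddCommGroup k

/-- The action of a permutation on `O[m]`. -/
def actHom {n : ℕ} {p : ZMod 2} (σ : Equiv.Perm (Fin n)) :
    AdjoinOp O n p →ₗ[k] AdjoinOp O n p where
  toFun := Quotient.map (.act σ) fun _ _ h => .congr_act σ h
  map_add' x y := by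
    induction x using ind; induction y using ind
    exact sound (.act_add _ _ _)
  map_smul' r x := by
    induction x using ind
    exact sound (.act_smul _ _ _)

/-- The partial compositions of `O[m]`. -/
def compHom {a b c : ℕ} {p q s : ZMod 2} (i : Fin a) (hc : a + b = c + 1) (hs : p + q = s) :
    AdjoinOp O a p →ₗ[k] AdjoinOp O b q →ₗ[k] AdjoinOp O c s :=
  LinearMap.mk₂ k
    (Quotient.map₂ (.comp i hc hs) fun _ _ h _ _ h' => .congr_comp i hc hs h h')
    (fun x x' y => by
      induction x using ind; induction x' using ind; induction y using ind
      exact sound (.comp_add_left _ _ _ _ _ _))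
    (fun r x y => by
      induction x using ind; induction y using ind
      exact sound (.comp_smul_left _ _ _ _ _ _))
    (fun x y y' => by
      induction x using ind; induction y using ind; induction y' using ind
      exact sound (.comp_add_right _ _ _ _ _ _))
    (fun r x y => by
      induction x using ind; induction y using ind
      exact sound (.comp_smul_right _ _ _ _ _ _))

end AdjoinOp

/-- The operad `O[m]` obtained from `O` by freely adjoining an odd unary operation `m`. -/
def adjoin (O : SuperOperad.{u, v} k) : SuperOperad.{u, max u v} k where
  Op := AdjoinOp O
  act :=
    { toFun := AdjoinOp.actHom
      map_one' := by
        ext x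
        induction x using AdjoinOp.ind
        exact AdjoinOp.sound (.act_one _)
      map_mul' := fun σ τ => by
        ext x
        induction x using AdjoinOp.ind
        exact AdjoinOp.sound (.act_mul _ _ _) }
  comp := AdjoinOp.compHom
  comp_act := by
    intro a b c p q s i hc hs σ τ x y
    induction x using AdjoinOp.ind; induction y using AdjoinOp.ind
    exact AdjoinOp.sound (.comp_act _ _ _ _ _ _ _)
  comp_seq := by
    intro a b c ab bc r p q s pq qs t i j h₁ h₂ h₃ h₄ e₁ e₂ e₃ e₄ x y z
    induction x using AdjoinOp.ind; induction y using AdjoinOp.ind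
    induction z using AdjoinOp.ind
    exact AdjoinOp.sound (.comp_seq _ _ _ _ _ _ _ _ _ _ _ _ _)
  comp_par := by
    intro a b c ab ac r p q s pq ps t i j hij h₁ h₂ h₃ h₄ e₁ e₂ e₃ e₄ x y z
    induction x using AdjoinOp.ind; induction y using AdjoinOp.ind
    induction z using AdjoinOp.ind
    exact AdjoinOp.sound (.comp_par _ _ _ _ _ _ _ _ _ _ _ _ _ _)

section

variable {O : SuperOperad.{u, v} k}

/-- The operation of `O[m]` given by a formal expression. -/
def adjoinMk {n : ℕ} {p : ZMod 2} (x : AdjoinExpr O n p) : O.adjoin.Op n p := AdjoinOp.mk x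

theorem adjoinMk_eq {n : ℕ} {p : ZMod 2} {x y : AdjoinExpr O n p} (h : AdjoinRel O x y) :
    adjoinMk x = adjoinMk y := AdjoinOp.sound h

theorem adjoin_ind {n : ℕ} {p : ZMod 2} {C : O.adjoin.Op n p → Prop}
    (h : ∀ x, C (adjoinMk x)) (x : O.adjoin.Op n p) : C x :=
  AdjoinOp.ind h x

theorem adjoinMk_zero {n : ℕ} {p : ZMod 2} :
    adjoinMk (.zero : AdjoinExpr O n p) = 0 := rfl

theorem adjoinMk_add {n : ℕ} {p : ZMod 2} (x y : AdjoinExpr O n p) :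
    adjoinMk (.add x y) = adjoinMk x + adjoinMk y := rfl

theorem adjoinMk_smul {n : ℕ} {p : ZMod 2} (r : k) (x : AdjoinExpr O n p) :
    adjoinMk (.smul r x) = r • adjoinMk x := rfl

theorem adjoinMk_act {n : ℕ} {p : ZMod 2} (σ : Equiv.Perm (Fin n)) (x : AdjoinExpr O n p) :
    adjoinMk (.act σ x) = O.adjoin.act σ (adjoinMk x) := rfl

theorem adjoinMk_comp {a b c : ℕ} {p q s : ZMod 2} (i : Fin a) (hc : a + b = c + 1)
    (hs : p + q = s) (x : AdjoinExpr O a p) (y : AdjoinExpr O b q) :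
    adjoinMk (.comp i hc hs x y) = O.adjoin.comp i hc hs (adjoinMk x) (adjoinMk y) := rfl

end

/-- The new generator `m` of `O[m]`. -/
def adjoinGen (O : SuperOperad.{u, v} k) : O.adjoin.Op 1 1 := adjoinMk .m

/-- The canonical map from `O` to `O[m]`. -/
def adjoinOf (O : SuperOperad.{u, v} k) {n : ℕ} {p : ZMod 2} : O.Op n p →ₗ[k] O.adjoin.Op n p where
  toFun x := adjoinMk (.of x)
  map_add' _ _ := adjoinMk_eq (.of_add _ _)
  map_smul' _ _ := adjoinMk_eq (.of_smul _ _)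

theorem adjoinOf_act {O : SuperOperad.{u, v} k} {n : ℕ} {p : ZMod 2} (σ : Equiv.Perm (Fin n))
    (x : O.Op n p) : O.adjoinOf (O.act σ x) = O.adjoin.act σ (O.adjoinOf x) :=
  adjoinMk_eq (.of_act _ _)

theorem adjoinOf_comp {O : SuperOperad.{u, v} k} {a b c : ℕ} {p q s : ZMod 2} (i : Fin a)
    (hc : a + b = c + 1) (hs : p + q = s) (x : O.Op a p) (y : O.Op b q) :
    O.adjoinOf (O.comp i hc hs x y) = O.adjoin.comp i hc hs (O.adjoinOf x) (O.adjoinOf y) :=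
  adjoinMk_eq (.of_comp _ _ _ _ _)

end SuperOperad

namespace DGOperad

open SuperOperad

variable {k : Type u} [Field k] (O : DGOperad.{u, v} k)

/-- The differential of `O[m]` on formal expressions: it extends the differential of `O`, sends `m`
to `-m²`, and is an odd derivation. -/
def adjoinDiffExpr {n : ℕ} {p : ZMod 2} : AdjoinExpr O.toSuperOperad n p →
    ∀ {t : ZMod 2}, p + 1 = t → O.toSuperOperad.adjoin.Op n t
  | .of x, _, ht => O.adjoinOf (O.d ht x)
  | .m, _, ht => -O.toSuperOperad.adjoin.comp 0 rfl ht O.adjoinGen O.adjoinGen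
  | .zero, _, _ => 0
  | .add x y, _, ht => adjoinDiffExpr x ht + adjoinDiffExpr y ht
  | .smul r x, _, ht => r • adjoinDiffExpr x ht
  | .act σ x, _, ht => O.toSuperOperad.adjoin.act σ (adjoinDiffExpr x ht)
  | .comp (p := p) i hc hs x y, _, ht =>
      O.toSuperOperad.adjoin.comp i hc (by rw [← ht, ← hs, add_right_comm]) (adjoinDiffExpr x rfl)
          (adjoinMk y) +
        paritySign k p • O.toSuperOperad.adjoin.comp i hc (by rw [← ht, ← hs, add_assoc]) (adjoinMk x)
          (adjoinDiffExpr y rfl)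

variable {O}

theorem adjoinDiffExpr_rel {n : ℕ} {p : ZMod 2} {x y : AdjoinExpr O.toSuperOperad n p}
    (h : AdjoinRel O.toSuperOperad x y) :
    ∀ {t : ZMod 2} (ht : p + 1 = t), O.adjoinDiffExpr x ht = O.adjoinDiffExpr y ht := by
  induction h with
  | refl x => intros; rfl
  | symm _ ih => intro t ht; exact (ih ht).symm
  | trans _ _ ih ih' => intro t ht; exact (ih ht).trans (ih' ht)
  | congr_add _ _ ih ih' => intro t ht; simp only [adjoinDiffExpr, ih ht, ih' ht]
  | congr_smul r _ ih => intro t ht; simp only [adjoinDiffExpr, ih ht]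
  | congr_act σ _ ih => intro t ht; simp only [adjoinDiffExpr, ih ht]
  | congr_comp i hc hs h h' ih ih' =>
    intro t ht
    simp only [adjoinDiffExpr, ih, ih', adjoinMk_eq h, adjoinMk_eq h']
  | add_assoc x y z => intros; simp only [adjoinDiffExpr, add_assoc]
  | add_comm x y => intros; simp only [adjoinDiffExpr, add_comm]
  | zero_add x => intros; simp only [adjoinDiffExpr, zero_add]
  | zero_smul x => intros; simp only [adjoinDiffExpr, zero_smul]
  | one_smul x => intros; simp only [adjoinDiffExpr, one_smul]
  | mul_smul r r' x => intros; simp only [adjoinDiffExpr, mul_smul]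
  | add_smul r r' x => intros; simp only [adjoinDiffExpr, add_smul]
  | smul_add r x y => intros; simp only [adjoinDiffExpr, smul_add]
  | act_add σ x y => intros; simp only [adjoinDiffExpr, map_add]
  | act_smul σ r x => intros; simp only [adjoinDiffExpr, map_smul]
  | act_one x => intros; simp only [adjoinDiffExpr, map_one, Module.End.one_apply]
  | act_mul σ τ x => intros; simp only [adjoinDiffExpr, map_mul, Module.End.mul_apply]
  | comp_add_left i hc hs x x' y =>
    intro t ht
    simp only [adjoinDiffExpr, adjoinMk_add, map_add, LinearMap.add_apply, smul_add]
    abel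
  | comp_smul_left i hc hs r x y =>
    intro t ht
    simp only [adjoinDiffExpr, adjoinMk_smul, map_smul, LinearMap.smul_apply, smul_add]
    rw [smul_comm]
  | comp_add_right i hc hs x y y' =>
    intro t ht
    simp only [adjoinDiffExpr, adjoinMk_add, map_add, smul_add]
    abel
  | comp_smul_right i hc hs r x y =>
    intro t ht
    simp only [adjoinDiffExpr, adjoinMk_smul, map_smul, smul_add]
    rw [smul_comm]
  | comp_act i hc hs σ τ x y =>
    intro t ht
    simp only [adjoinDiffExpr, adjoinMk_act, map_add, map_smul, O.toSuperOperad.adjoin.comp_act]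
  | comp_seq i j h₁ h₂ h₃ h₄ e₁ e₂ e₃ e₄ x y z =>
    intro t ht
    simp only [adjoinDiffExpr, adjoinMk_comp, map_add, map_smul, LinearMap.add_apply,
      LinearMap.smul_apply, smul_add, smul_smul, ← e₁, paritySign_add]
    rw [O.toSuperOperad.adjoin.comp_seq i j h₁ h₂ h₃ h₄ _ _ e₃ _ _ (adjoinMk y) (adjoinMk z),
      O.toSuperOperad.adjoin.comp_seq i j h₁ h₂ h₃ h₄ _ _ _ _ (adjoinMk x) _ (adjoinMk z),
      O.toSuperOperad.adjoin.comp_seq i j h₁ h₂ h₃ h₄ _ _ _ _ (adjoinMk x) (adjoinMk y) _, add_assoc]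
  | @comp_par _ _ _ _ _ _ p q s _ _ _ i j hij h₁ h₂ h₃ h₄ e₁ e₂ e₃ e₄ x y z =>
    intro t ht
    subst e₁ e₃ ht
    have c₁ : paritySign k p * paritySign k ((q + 1) * s) =
        paritySign k (q * s) * (paritySign k p * paritySign k s) := by
      rw [add_mul, one_mul, paritySign_add]; ring
    have c₂ : paritySign k p * paritySign k q * paritySign k (q * (s + 1)) =
        paritySign k (q * s) * paritySign k p := by
      rw [mul_add, mul_one, paritySign_add]
      linear_combination (paritySign k (q * s) * paritySign k p) * paritySign_mul_self k q
    simp only [adjoinDiffExpr, adjoinMk_comp, map_add, map_smul, LinearMap.add_apply,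
      LinearMap.smul_apply, smul_add, smul_smul, paritySign_add]
    rw [O.toSuperOperad.adjoin.comp_par i j hij h₁ h₂ h₃ h₄ _ _ (by ring : p + 1 + s = p + s + 1)
        (by rw [← e₄]; ring) _ (adjoinMk y) (adjoinMk z),
      O.toSuperOperad.adjoin.comp_par i j hij h₁ h₂ h₃ h₄ _ _ rfl (by rw [← e₄]; ring) (adjoinMk x) _
        (adjoinMk z),
      O.toSuperOperad.adjoin.comp_par i j hij h₁ h₂ h₃ h₄ _ _ (by ring : p + (s + 1) = p + s + 1)
        (by rw [← e₄]; ring) (adjoinMk x) (adjoinMk y) _]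
    simp only [smul_smul, c₁, c₂]
    abel
  | of_add x y => intros; simp only [adjoinDiffExpr, map_add]
  | of_smul r x => intros; simp only [adjoinDiffExpr, map_smul]
  | of_act σ x =>
    intro t ht
    simp only [adjoinDiffExpr, O.d_act, adjoinOf_act]
  | of_comp i hc hs x y =>
    intro t ht
    simp only [adjoinDiffExpr]
    rw [O.d_comp i hc hs ht rfl (by rw [← ht, ← hs, add_right_comm]) rfl
      (by rw [← ht, ← hs, add_assoc]), map_add, map_smul, adjoinOf_comp, adjoinOf_comp]
    rfl

/-- The differential of `O[m]`. -/
def adjoinDiff (O : DGOperad.{u, v} k) {n : ℕ} {p q : ZMod 2} (h : p + 1 = q) :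
    O.toSuperOperad.adjoin.Op n p →ₗ[k] O.toSuperOperad.adjoin.Op n q where
  toFun := Quotient.lift (fun x => O.adjoinDiffExpr x h) fun _ _ e => adjoinDiffExpr_rel e h
  map_add' x y := by
    induction x using adjoin_ind; induction y using adjoin_ind
    rfl
  map_smul' r x := by
    induction x using adjoin_ind
    rfl

theorem adjoinDiff_act {n : ℕ} {p q : ZMod 2} (h : p + 1 = q) (σ : Equiv.Perm (Fin n))
    (x : O.toSuperOperad.adjoin.Op n p) :
    O.adjoinDiff h (O.toSuperOperad.adjoin.act σ x) =
      O.toSuperOperad.adjoin.act σ (O.adjoinDiff h x) := by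
  induction x using adjoin_ind
  rfl

theorem adjoinDiff_comp {a b c : ℕ} {p p' q q' s t : ZMod 2} (i : Fin a) (hc : a + b = c + 1)
    (hs : p + q = s) (ht : s + 1 = t) (hp : p + 1 = p') (hp' : p' + q = t) (hq : q + 1 = q')
    (hq' : p + q' = t) (x : O.toSuperOperad.adjoin.Op a p) (y : O.toSuperOperad.adjoin.Op b q) :
    O.adjoinDiff ht (O.toSuperOperad.adjoin.comp i hc hs x y) =
      O.toSuperOperad.adjoin.comp i hc hp' (O.adjoinDiff hp x) y +
        paritySign k p • O.toSuperOperad.adjoin.comp i hc hq' x (O.adjoinDiff hq y) := by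
  subst hp hq
  induction x using adjoin_ind; induction y using adjoin_ind
  rfl

theorem adjoinDiffExpr_adjoinDiffExpr {n : ℕ} {p : ZMod 2} (x : AdjoinExpr O.toSuperOperad n p) :
    ∀ {t s : ZMod 2} (ht : p + 1 = t) (hs : t + 1 = s),
      O.adjoinDiff hs (O.adjoinDiffExpr x ht) = 0 := by
  induction x with
  | of x =>
    intro t s ht hs
    change O.adjoinOf (O.d hs (O.d ht x)) = 0
    rw [O.d_d, map_zero]
  | m =>
    intro t s ht hs
    simp only [adjoinDiffExpr, map_neg]
    rw [adjoinDiff_comp 0 rfl ht hs one_add_one_parity (by rw [← hs, ← ht]; rfl)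
      one_add_one_parity (by rw [← hs, ← ht]; rfl)]
    have e : O.adjoinDiff one_add_one_parity O.adjoinGen =
        -O.toSuperOperad.adjoin.comp 0 rfl one_add_one_parity O.adjoinGen O.adjoinGen := rfl
    have h := O.toSuperOperad.adjoin.comp_seq (0 : Fin 1) (0 : Fin 1) rfl rfl rfl rfl
      one_add_one_parity (by rw [← hs, ← ht]; rfl : 0 + 1 = s) one_add_one_parity
      (by rw [← hs, ← ht]; rfl) O.adjoinGen O.adjoinGen O.adjoinGen
    rw [insertEquiv_one_left] at h
    rw [e, map_neg, map_neg, LinearMap.neg_apply, h, paritySign_one, neg_one_smul, neg_neg,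
      neg_add_cancel, neg_zero]
  | zero => intros; simp only [adjoinDiffExpr, map_zero]
  | add x y ih ih' => intro t s ht hs; simp only [adjoinDiffExpr, map_add, ih, ih', add_zero]
  | smul r x ih => intro t s ht hs; simp only [adjoinDiffExpr, map_smul, ih, smul_zero]
  | act σ x ih => intro t s ht hs; simp only [adjoinDiffExpr, adjoinDiff_act, ih, map_zero]
  | @comp a b c p q r i hc hs x y ih ih' =>
    intro t t' ht ht'
    have hx : O.adjoinDiff rfl (adjoinMk x) = O.adjoinDiffExpr x rfl := rfl
    have hy : O.adjoinDiff rfl (adjoinMk y) = O.adjoinDiffExpr y rfl := rfl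
    simp only [adjoinDiffExpr, map_add, map_smul]
    rw [adjoinDiff_comp i hc _ ht' rfl (by rw [← ht', ← ht, ← hs]; ring) rfl
        (by rw [← ht', ← ht, ← hs]; ring) (O.adjoinDiffExpr x rfl) (adjoinMk y),
      adjoinDiff_comp i hc _ ht' rfl (by rw [← ht', ← ht, ← hs]; ring) rfl
        (by rw [← ht', ← ht, ← hs]; ring) (adjoinMk x) (O.adjoinDiffExpr y rfl),
      ih, ih', hx, hy, paritySign_add, paritySign_one]
    simp

/-- The dg operad `O[m]`, obtained from the dg operad `O` by freely adjoining an odd unary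
operation `m`, with the differential that extends the one of `O` and satisfies `d m = -m²`. -/
def adjoin (O : DGOperad.{u, v} k) : DGOperad.{u, max u v} k where
  toSuperOperad := O.toSuperOperad.adjoin
  d := adjoinDiff O
  d_d := by
    intro n p q s h h' x
    induction x using adjoin_ind with
    | h x => exact adjoinDiffExpr_adjoinDiffExpr x h h'
  d_act := adjoinDiff_act
  d_comp := adjoinDiff_comp

/-- The inclusion of dg operads `O → O[m]`. -/
def adjoinInclusion (O : DGOperad.{u, v} k) : Hom O O.adjoin where
  app := O.adjoinOf
  app_act := adjoinOf_act
  app_comp := adjoinOf_comp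
  app_d _ _ := rfl

/-- The operation `m` is a Maurer-Cartan element of `O[m]`. -/
theorem isMaurerCartan_adjoinGen [CharZero k] (O : DGOperad.{u, v} k) :
    O.adjoin.IsMaurerCartan O.adjoinGen := by
  have h2 : (2⁻¹ : k) * 2 = 1 := inv_mul_cancel₀ two_ne_zero
  have h : O.adjoin.bracket one_add_one_parity O.adjoinGen O.adjoinGen =
      (2 : k) • O.adjoin.comp 0 rfl one_add_one_parity O.adjoinGen O.adjoinGen := by
    simp only [SuperOperad.bracket, mul_one, paritySign_one, two_smul, neg_smul, one_smul,
      sub_neg_eq_add]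
  unfold IsMaurerCartan
  rw [h, smul_smul, h2, one_smul]
  exact neg_add_cancel
    (O.toSuperOperad.adjoin.comp 0 rfl one_add_one_parity O.adjoinGen O.adjoinGen)

/-- The hat construction: the twisting of `O[m]` by its Maurer-Cartan element `m`. -/
def hat [CharZero k] (O : DGOperad.{u, v} k) : DGOperad.{u, max u v} k :=
  O.adjoin.twist O.adjoinGen O.isMaurerCartan_adjoinGen

end DGOperad

/-! Informally, `O[m]` consists of trees of operations of `O` with a string `m^j`, `j ≥ 0`, on each
edge. On strings, `d` sends `m^j` to `-m^(j+1)` for odd `j` and to `0` for even `j`, so the nonempty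
strings pair off, and the trees with only empty strings are the operations of `O`. The homotopy that
shortens a string by one copy of `m` turns this into a proof: if `h` sums these shortenings, with
signs, over all the edges, then `-(dh + hd)` multiplies a tree by its number `N` of nonempty
strings. Since `N` is invertible in characteristic zero unless `N = 0`, the homology comes from the
part with `N = 0`, that is from `O`.

For `hat O`, the root edge alone suffices. The twisted differential adds one more `m` at the root,
so there `m^j` goes to `m^(j+1)` for even `j`, including `j = 0`, and to `0` for odd `j`. Removing
one `m` at the root (`leftDeriv`) anticommutes up to correction terms with the rest of the
differential and is a contracting homotopy (`leftDeriv_twist_d`).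

No basis of trees is constructed. The operators are defined by recursion on the presentation of
`O[m]` (`AdjoinRecursor`), and each relation of the presentation is checked. As `O[m]` has no unit,
shortening `m` itself needs care: the missing unit is simulated by the coefficient of `m`
(`genCoeff`). The homotopy is split into `leftDeriv` at the root and `upperContraction` on the other
edges; to avoid treating an edge twice, the latter must know whether a string ends at a given input
(`rightProj`).

The identities that carry the proof are `adjoinDiff_leftDeriv`, `upperCount_comp` and
`leftDeriv_inner`. In place of an eigenspace decomposition for `N`, `exists_aeval_stringCount_eq`
gives a polynomial `f` with `f(0) = 1` and `f(N) x` in `O`. Injectivity, also on homology, comes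
from the retraction `m ↦ 0`. -/

namespace SuperOperad

variable {k : Type u} [Field k]

/-! ### Induction and recursion on the operations of `O[m]`. -/

theorem adjoin_induction {O : SuperOperad.{u, v} k}
    {C : ∀ {n : ℕ} {p : ZMod 2}, O.adjoin.Op n p → Prop}
    (of : ∀ {n : ℕ} {p : ZMod 2} (x : O.Op n p), C (O.adjoinOf x))
    (gen : C O.adjoinGen)
    (zero : ∀ {n : ℕ} {p : ZMod 2}, C (0 : O.adjoin.Op n p))
    (add : ∀ {n : ℕ} {p : ZMod 2} (x y : O.adjoin.Op n p), C x → C y → C (x + y))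
    (smul : ∀ {n : ℕ} {p : ZMod 2} (r : k) (x : O.adjoin.Op n p), C x → C (r • x))
    (act : ∀ {n : ℕ} {p : ZMod 2} (σ : Equiv.Perm (Fin n)) (x : O.adjoin.Op n p), C x →
      C (O.adjoin.act σ x))
    (comp : ∀ {a b c : ℕ} {p q s : ZMod 2} (i : Fin a) (hc : a + b = c + 1) (hs : p + q = s)
      (x : O.adjoin.Op a p) (y : O.adjoin.Op b q), C x → C y → C (O.adjoin.comp i hc hs x y))
    {n : ℕ} {p : ZMod 2} (x : O.adjoin.Op n p) : C x := by
  induction x using adjoin_ind with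
  | h x =>
    induction x with
    | of x => exact of x
    | m => exact gen
    | zero => exact zero
    | add x y hx hy => exact add _ _ hx hy
    | smul r x hx => exact smul r _ hx
    | act σ x hx => exact act σ _ hx
    | comp i hc hs x y hx hy => exact comp i hc hs _ _ hx hy

/-- The data needed to define by recursion equivariant linear maps on the operations of `O[m]`: the
values on `O` and on `m`, and the value on `x ∘_i y` in terms of `x`, `y` and the values on `x` and
`y`, compatible with the axioms of operads. -/
structure AdjoinRecursor (O : SuperOperad.{u, v} k) (T : ℕ → ZMod 2 → Type w)
    [∀ n p, AddCommGroup (T n p)] [∀ n p, Module k (T n p)] where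
  /-- the action of the symmetric groups on the values -/
  act : ∀ {n : ℕ} {p : ZMod 2}, Representation k (Equiv.Perm (Fin n)) (T n p)
  /-- the values on `O` -/
  of : ∀ {n : ℕ} {p : ZMod 2}, O.Op n p →ₗ[k] T n p
  /-- the value on `m` -/
  gen : T 1 1
  /-- the value on a partial composition -/
  comp : ∀ {a b c : ℕ} {p q s : ZMod 2} (_ : Fin a) (_ : a + b = c + 1) (_ : p + q = s),
    O.adjoin.Op a p → T a p → O.adjoin.Op b q → T b q → T c s
  comp_add_left : ∀ {a b c : ℕ} {p q s : ZMod 2} (i : Fin a) (hc : a + b = c + 1)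
    (hs : p + q = s) (x x' : O.adjoin.Op a p) (t t' : T a p) (y : O.adjoin.Op b q) (u : T b q),
    comp i hc hs (x + x') (t + t') y u = comp i hc hs x t y u + comp i hc hs x' t' y u
  comp_smul_left : ∀ {a b c : ℕ} {p q s : ZMod 2} (i : Fin a) (hc : a + b = c + 1)
    (hs : p + q = s) (r : k) (x : O.adjoin.Op a p) (t : T a p) (y : O.adjoin.Op b q) (u : T b q),
    comp i hc hs (r • x) (r • t) y u = r • comp i hc hs x t y u
  comp_add_right : ∀ {a b c : ℕ} {p q s : ZMod 2} (i : Fin a) (hc : a + b = c + 1)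
    (hs : p + q = s) (x : O.adjoin.Op a p) (t : T a p) (y y' : O.adjoin.Op b q) (u u' : T b q),
    comp i hc hs x t (y + y') (u + u') = comp i hc hs x t y u + comp i hc hs x t y' u'
  comp_smul_right : ∀ {a b c : ℕ} {p q s : ZMod 2} (i : Fin a) (hc : a + b = c + 1)
    (hs : p + q = s) (r : k) (x : O.adjoin.Op a p) (t : T a p) (y : O.adjoin.Op b q) (u : T b q),
    comp i hc hs x t (r • y) (r • u) = r • comp i hc hs x t y u
  comp_act : ∀ {a b c : ℕ} {p q s : ZMod 2} (i : Fin a) (hc : a + b = c + 1) (hs : p + q = s)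
    (σ : Equiv.Perm (Fin a)) (τ : Equiv.Perm (Fin b))
    (x : O.adjoin.Op a p) (t : T a p) (y : O.adjoin.Op b q) (u : T b q),
    comp (σ i) hc hs (O.adjoin.act σ x) (act σ t) (O.adjoin.act τ y) (act τ u) =
      act (blockPerm hc i σ τ) (comp i hc hs x t y u)
  comp_seq : ∀ {a b c ab bc r : ℕ} {p q s pq qs t : ZMod 2} (i : Fin a) (j : Fin b)
    (h₁ : a + b = ab + 1) (h₂ : ab + c = r + 1) (h₃ : b + c = bc + 1) (h₄ : a + bc = r + 1)
    (e₁ : p + q = pq) (e₂ : pq + s = t) (e₃ : q + s = qs) (e₄ : p + qs = t)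
    (x : O.adjoin.Op a p) (x' : T a p) (y : O.adjoin.Op b q) (y' : T b q)
    (z : O.adjoin.Op c s) (z' : T c s),
    comp (insertEquiv h₁ i (Sum.inr j)) h₂ e₂ (O.adjoin.comp i h₁ e₁ x y)
        (comp i h₁ e₁ x x' y y') z z' =
      comp i h₄ e₄ x x' (O.adjoin.comp j h₃ e₃ y z) (comp j h₃ e₃ y y' z z')
  comp_par : ∀ {a b c ab ac r : ℕ} {p q s pq ps t : ZMod 2} (i j : Fin a) (hij : j ≠ i)
    (h₁ : a + b = ab + 1) (h₂ : ab + c = r + 1) (h₃ : a + c = ac + 1) (h₄ : ac + b = r + 1)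
    (e₁ : p + q = pq) (e₂ : pq + s = t) (e₃ : p + s = ps) (e₄ : ps + q = t)
    (x : O.adjoin.Op a p) (x' : T a p) (y : O.adjoin.Op b q) (y' : T b q)
    (z : O.adjoin.Op c s) (z' : T c s),
    comp (insertEquiv h₁ i (Sum.inl ⟨j, hij⟩)) h₂ e₂ (O.adjoin.comp i h₁ e₁ x y)
        (comp i h₁ e₁ x x' y y') z z' =
      paritySign k (q * s) •
        comp (insertEquiv h₃ j (Sum.inl ⟨i, hij.symm⟩)) h₄ e₄ (O.adjoin.comp j h₃ e₃ x z)
          (comp j h₃ e₃ x x' z z') y y'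
  of_act : ∀ {n : ℕ} {p : ZMod 2} (σ : Equiv.Perm (Fin n)) (x : O.Op n p),
    of (O.act σ x) = act σ (of x)
  of_comp : ∀ {a b c : ℕ} {p q s : ZMod 2} (i : Fin a) (hc : a + b = c + 1) (hs : p + q = s)
    (x : O.Op a p) (y : O.Op b q),
    of (O.comp i hc hs x y) = comp i hc hs (O.adjoinOf x) (of x) (O.adjoinOf y) (of y)

namespace AdjoinRecursor

variable {O : SuperOperad.{u, v} k} {T : ℕ → ZMod 2 → Type w}
  [∀ n p, AddCommGroup (T n p)] [∀ n p, Module k (T n p)] (R : AdjoinRecursor O T)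

/-- The value on a formal expression. -/
def onExpr {n : ℕ} {p : ZMod 2} : AdjoinExpr O n p → T n p
  | .of x => R.of x
  | .m => R.gen
  | .zero => 0
  | .add x y => onExpr x + onExpr y
  | .smul r x => r • onExpr x
  | .act σ x => R.act σ (onExpr x)
  | .comp i hc hs x y => R.comp i hc hs (adjoinMk x) (onExpr x) (adjoinMk y) (onExpr y)

/-- Each relation of the presentation is a field of the recursor, a module axiom in the target, or
linearity of a map. The rule `comp` also sees the operations themselves, through their classes, so
congruence for compositions uses `adjoinMk_eq` besides the induction hypotheses. -/
theorem onExpr_rel {n : ℕ} {p : ZMod 2} {x y : AdjoinExpr O n p} (h : AdjoinRel O x y) :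
    R.onExpr x = R.onExpr y := by
  induction h with
  | refl x => rfl
  | symm _ ih => exact ih.symm
  | trans _ _ ih ih' => exact ih.trans ih'
  | congr_add _ _ ih ih' => simp only [onExpr, ih, ih']
  | congr_smul r _ ih => simp only [onExpr, ih]
  | congr_act σ _ ih => simp only [onExpr, ih]
  | congr_comp i hc hs h h' ih ih' => simp only [onExpr, ih, ih', adjoinMk_eq h, adjoinMk_eq h']
  | add_assoc x y z => exact add_assoc _ _ _
  | add_comm x y => exact add_comm _ _
  | zero_add x => exact zero_add _
  | zero_smul x => exact zero_smul _ _
  | one_smul x => exact one_smul _ _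
  | mul_smul r r' x => exact mul_smul _ _ _
  | add_smul r r' x => exact add_smul _ _ _
  | smul_add r x y => exact smul_add _ _ _
  | act_add σ x y => exact map_add _ _ _
  | act_smul σ r x => exact map_smul _ _ _
  | act_one x => simp only [onExpr, map_one, Module.End.one_apply]
  | act_mul σ τ x => simp only [onExpr, map_mul, Module.End.mul_apply]
  | comp_add_left i hc hs x x' y =>
    exact R.comp_add_left i hc hs (adjoinMk x) (adjoinMk x') _ _
      (adjoinMk y) _
  | comp_smul_left i hc hs r x y => exact R.comp_smul_left i hc hs r (adjoinMk x) _ (adjoinMk y) _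
  | comp_add_right i hc hs x y y' =>
    exact R.comp_add_right i hc hs (adjoinMk x) _ (adjoinMk y)
      (adjoinMk y') _ _
  | comp_smul_right i hc hs r x y => exact R.comp_smul_right i hc hs r (adjoinMk x) _ (adjoinMk y) _
  | comp_act i hc hs σ τ x y => exact R.comp_act i hc hs σ τ (adjoinMk x) _ (adjoinMk y) _
  | comp_seq i j h₁ h₂ h₃ h₄ e₁ e₂ e₃ e₄ x y z =>
    exact R.comp_seq i j h₁ h₂ h₃ h₄ e₁ e₂ e₃ e₄ (adjoinMk x) _ (adjoinMk y) _ (adjoinMk z) _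
  | comp_par i j hij h₁ h₂ h₃ h₄ e₁ e₂ e₃ e₄ x y z =>
    exact R.comp_par i j hij h₁ h₂ h₃ h₄ e₁ e₂ e₃ e₄ (adjoinMk x) _ (adjoinMk y) _ (adjoinMk z) _
  | of_add x y => exact map_add _ _ _
  | of_smul r x => exact map_smul _ _ _
  | of_act σ x => exact R.of_act σ x
  | of_comp i hc hs x y => exact R.of_comp i hc hs x y

/-- The linear map on the operations of `O[m]` defined by recursion. -/
def map {n : ℕ} {p : ZMod 2} : O.adjoin.Op n p →ₗ[k] T n p where
  toFun := Quotient.lift R.onExpr fun _ _ h => R.onExpr_rel h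
  map_add' x y := by
    induction x using adjoin_ind; induction y using adjoin_ind
    rfl
  map_smul' r x := by
    induction x using adjoin_ind
    rfl

theorem map_of {n : ℕ} {p : ZMod 2} (x : O.Op n p) : R.map (O.adjoinOf x) = R.of x := rfl

theorem map_gen : R.map O.adjoinGen = R.gen := rfl

theorem map_act {n : ℕ} {p : ZMod 2} (σ : Equiv.Perm (Fin n)) (x : O.adjoin.Op n p) :
    R.map (O.adjoin.act σ x) = R.act σ (R.map x) := by
  induction x using adjoin_ind
  rfl

theorem map_comp {a b c : ℕ} {p q s : ZMod 2} (i : Fin a) (hc : a + b = c + 1) (hs : p + q = s)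
    (x : O.adjoin.Op a p) (y : O.adjoin.Op b q) :
    R.map (O.adjoin.comp i hc hs x y) = R.comp i hc hs x (R.map x) y (R.map y) := by
  induction x using adjoin_ind; induction y using adjoin_ind
  rfl

end AdjoinRecursor

end SuperOperad

/-! ### Relabellings of iterated partial compositions -/

theorem insertEquiv_inl_val {a b c : ℕ} (h : a + b = c + 1) (i : Fin a) (j : {j : Fin a // j ≠ i}) :
    (insertEquiv h i (Sum.inl j)).1 = if j.1.1 < i.1 then j.1.1 else j.1.1 + b - 1 := rfl

theorem insertEquiv_inr_val {a b c : ℕ} (h : a + b = c + 1) (i : Fin a) (l : Fin b) :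
    (insertEquiv h i (Sum.inr l)).1 = i.1 + l.1 := rfl

/-- An input of `(x ∘_i y) ∘_j z = x ∘_i (y ∘_j z)` comes from `z`, from `y` or from `x`; this lemma
and the next two locate it on both sides. They are needed for operators indexed by an input. -/
theorem insertEquiv_seq_inr {a b c ab bc r : ℕ} (i : Fin a) (j : Fin b) (l : Fin c)
    (h₁ : a + b = ab + 1) (h₂ : ab + c = r + 1) (h₃ : b + c = bc + 1) (h₄ : a + bc = r + 1) :
    insertEquiv h₂ (insertEquiv h₁ i (Sum.inr j)) (Sum.inr l) =
      insertEquiv h₄ i (Sum.inr (insertEquiv h₃ j (Sum.inr l))) := by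
  ext; simp only [insertEquiv_inr_val, Nat.add_assoc]

theorem insertEquiv_seq_mid {a b c ab bc r : ℕ} (i : Fin a) (j l : Fin b) (hl : l ≠ j)
    (h₁ : a + b = ab + 1) (h₂ : ab + c = r + 1) (h₃ : b + c = bc + 1) (h₄ : a + bc = r + 1)
    (hl' : insertEquiv h₁ i (Sum.inr l) ≠ insertEquiv h₁ i (Sum.inr j)) :
    insertEquiv h₂ (insertEquiv h₁ i (Sum.inr j)) (Sum.inl ⟨insertEquiv h₁ i (Sum.inr l), hl'⟩) =
      insertEquiv h₄ i (Sum.inr (insertEquiv h₃ j (Sum.inl ⟨l, hl⟩))) := by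
  have := Fin.val_ne_of_ne hl
  ext; simp only [insertEquiv_inl_val, insertEquiv_inr_val, Nat.add_lt_add_iff_left]
  split_ifs <;> omega

theorem insertEquiv_seq_inl {a b c ab bc r : ℕ} (i l : Fin a) (j : Fin b) (hl : l ≠ i)
    (h₁ : a + b = ab + 1) (h₂ : ab + c = r + 1) (h₃ : b + c = bc + 1) (h₄ : a + bc = r + 1)
    (hl' : insertEquiv h₁ i (Sum.inl ⟨l, hl⟩) ≠ insertEquiv h₁ i (Sum.inr j)) :
    insertEquiv h₂ (insertEquiv h₁ i (Sum.inr j))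
        (Sum.inl ⟨insertEquiv h₁ i (Sum.inl ⟨l, hl⟩), hl'⟩) =
      insertEquiv h₄ i (Sum.inl ⟨l, hl⟩) := by
  have := Fin.val_ne_of_ne hl
  have := j.2
  ext; simp only [insertEquiv_inl_val, insertEquiv_inr_val]; split_ifs <;> omega

/-- For parallel compositions two lemmas suffice: the inputs of `y` are handled by this one with the
roles of `y` and `z` exchanged. -/
theorem insertEquiv_par_inr {a b c ab ac r : ℕ} (i j : Fin a) (hij : j ≠ i) (l : Fin c)
    (h₁ : a + b = ab + 1) (h₂ : ab + c = r + 1) (h₃ : a + c = ac + 1) (h₄ : ac + b = r + 1)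
    (hl : insertEquiv h₃ j (Sum.inr l) ≠ insertEquiv h₃ j (Sum.inl ⟨i, hij.symm⟩)) :
    insertEquiv h₂ (insertEquiv h₁ i (Sum.inl ⟨j, hij⟩)) (Sum.inr l) =
      insertEquiv h₄ (insertEquiv h₃ j (Sum.inl ⟨i, hij.symm⟩))
        (Sum.inl ⟨insertEquiv h₃ j (Sum.inr l), hl⟩) := by
  have := Fin.val_ne_of_ne hij
  have := l.2
  have := i.2
  have := j.2
  ext; simp only [insertEquiv_inl_val, insertEquiv_inr_val]; split_ifs <;> omega

theorem insertEquiv_par_inl {a b c ab ac r : ℕ} (i j l : Fin a) (hij : j ≠ i) (hli : l ≠ i)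
    (hlj : l ≠ j)
    (h₁ : a + b = ab + 1) (h₂ : ab + c = r + 1) (h₃ : a + c = ac + 1) (h₄ : ac + b = r + 1)
    (hl : insertEquiv h₁ i (Sum.inl ⟨l, hli⟩) ≠ insertEquiv h₁ i (Sum.inl ⟨j, hij⟩))
    (hl' : insertEquiv h₃ j (Sum.inl ⟨l, hlj⟩) ≠ insertEquiv h₃ j (Sum.inl ⟨i, hij.symm⟩)) :
    insertEquiv h₂ (insertEquiv h₁ i (Sum.inl ⟨j, hij⟩))
        (Sum.inl ⟨insertEquiv h₁ i (Sum.inl ⟨l, hli⟩), hl⟩) =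
      insertEquiv h₄ (insertEquiv h₃ j (Sum.inl ⟨i, hij.symm⟩))
        (Sum.inl ⟨insertEquiv h₃ j (Sum.inl ⟨l, hlj⟩), hl'⟩) := by
  have := Fin.val_ne_of_ne hij
  have := Fin.val_ne_of_ne hli
  have := Fin.val_ne_of_ne hlj
  have := l.2
  have := i.2
  have := j.2
  ext; simp only [insertEquiv_inl_val]; split_ifs <;> omega

/-! ### Comparison of components with equal indices. -/

namespace SuperOperad

variable {k : Type u} [Field k]

/-- The identity map between components with propositionally equal indices, and zero between other
components. -/
def recast (O : SuperOperad.{u, v} k) {a c : ℕ} {p t : ZMod 2} : O.Op a p →ₗ[k] O.Op c t :=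
  if h : a = c ∧ p = t then h.1 ▸ h.2 ▸ LinearMap.id else 0

theorem recast_self {O : SuperOperad.{u, v} k} {a : ℕ} {p : ZMod 2} (x : O.Op a p) :
    O.recast x = x := by
  simp [recast]

variable {O : SuperOperad.{u, v} k}

/-! ### The retraction of `O[m]` onto `O` -/

/-- Recursion data for the morphism `O[m] → O` that sends `m` to zero. -/
def adjoinRetractRecursor (O : SuperOperad.{u, v} k) : AdjoinRecursor O O.Op where
  act := O.act
  of := LinearMap.id
  gen := 0
  comp i hc hs _ t _ u := O.comp i hc hs t u
  comp_add_left := by simp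
  comp_smul_left := by simp
  comp_add_right := by simp
  comp_smul_right := by simp
  comp_act := by intros; apply O.comp_act
  comp_seq := by intros; apply O.comp_seq
  comp_par := by intros; apply O.comp_par
  of_act := by simp
  of_comp := by simp

/-- The morphism `O[m] → O` that sends `m` to zero. -/
def adjoinRetract (O : SuperOperad.{u, v} k) {n : ℕ} {p : ZMod 2} : O.adjoin.Op n p →ₗ[k] O.Op n p :=
  O.adjoinRetractRecursor.map

theorem adjoinRetract_of {n : ℕ} {p : ZMod 2} (x : O.Op n p) :
    O.adjoinRetract (O.adjoinOf x) = x := rfl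

theorem adjoinRetract_gen : O.adjoinRetract O.adjoinGen = 0 := rfl

theorem adjoinRetract_act {n : ℕ} {p : ZMod 2} (σ : Equiv.Perm (Fin n)) (x : O.adjoin.Op n p) :
    O.adjoinRetract (O.adjoin.act σ x) = O.act σ (O.adjoinRetract x) :=
  O.adjoinRetractRecursor.map_act σ x

theorem adjoinRetract_comp {a b c : ℕ} {p q s : ZMod 2} (i : Fin a) (hc : a + b = c + 1)
    (hs : p + q = s) (x : O.adjoin.Op a p) (y : O.adjoin.Op b q) :
    O.adjoinRetract (O.adjoin.comp i hc hs x y) =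
      O.comp i hc hs (O.adjoinRetract x) (O.adjoinRetract y) :=
  O.adjoinRetractRecursor.map_comp i hc hs x y

/-! ### The coefficient of `m` -/

/-- Recursion data for the coefficient of `m`. -/
def genCoeffRecursor (O : SuperOperad.{u, v} k) : AdjoinRecursor O (fun _ _ => k) where
  act := 1
  of := 0
  gen := 1
  comp _ _ _ _ _ _ _ := 0
  comp_add_left := by simp
  comp_smul_left := by simp
  comp_add_right := by simp
  comp_smul_right := by simp
  comp_act := by simp
  comp_seq := by simp
  comp_par := by simp
  of_act := by simp
  of_comp := by simp

/-- The coefficient of `m` in an operation of `O[m]`. -/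
def genCoeff (O : SuperOperad.{u, v} k) {n : ℕ} {p : ZMod 2} : O.adjoin.Op n p →ₗ[k] k :=
  O.genCoeffRecursor.map

theorem genCoeff_of {n : ℕ} {p : ZMod 2} (x : O.Op n p) : O.genCoeff (O.adjoinOf x) = 0 := rfl

theorem genCoeff_gen : O.genCoeff O.adjoinGen = 1 := rfl

theorem genCoeff_act {n : ℕ} {p : ZMod 2} (σ : Equiv.Perm (Fin n)) (x : O.adjoin.Op n p) :
    O.genCoeff (O.adjoin.act σ x) = O.genCoeff x :=
  O.genCoeffRecursor.map_act σ x

theorem genCoeff_comp {a b c : ℕ} {p q s : ZMod 2} (i : Fin a) (hc : a + b = c + 1)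
    (hs : p + q = s) (x : O.adjoin.Op a p) (y : O.adjoin.Op b q) :
    O.genCoeff (O.adjoin.comp i hc hs x y) = 0 :=
  O.genCoeffRecursor.map_comp i hc hs x y

/-- This makes the terms `genCoeff x • recast y` meaningful: either the coefficient vanishes, or `x`
has the arity and parity of `m`, and composing with `x` in the place of a unit gives the right
indices. -/
theorem genCoeff_eq_zero_or {n : ℕ} {p : ZMod 2} (x : O.adjoin.Op n p) :
    O.genCoeff x = 0 ∨ n = 1 ∧ p = 1 := by
  by_cases h : n = 1 ∧ p = 1
  · exact .inr h
  · refine .inl ?_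
    revert h
    induction x using adjoin_induction with
    | of x => simp [genCoeff_of]
    | gen => simp
    | zero => simp
    | add x y hx hy => intro h; rw [map_add, hx h, hy h, add_zero]
    | smul r x hx => intro h; rw [map_smul, hx h, smul_zero]
    | act σ x hx => rwa [genCoeff_act]
    | comp i hc hs x y => simp [genCoeff_comp]

/-! ### The left and right projections -/

/-- Recursion data for the left projection. -/
def leftProjRecursor (O : SuperOperad.{u, v} k) : AdjoinRecursor O O.adjoin.Op where
  act := O.adjoin.act
  of := 0
  gen := O.adjoinGen
  comp i hc hs _ t y _ := O.adjoin.comp i hc hs t y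
  comp_add_left := by simp
  comp_smul_left := by simp
  comp_add_right := by simp
  comp_smul_right := by simp
  comp_act := by intros; apply O.adjoin.comp_act
  comp_seq := by intros; apply O.adjoin.comp_seq
  comp_par := by intros; apply O.adjoin.comp_par
  of_act := by simp
  of_comp := by simp

/-- The projection of `O[m]` onto the span of `m` and of the operations `m ∘_1 x` that vanishes on
the operations with an operation of `O` at the root. -/
def leftProj (O : SuperOperad.{u, v} k) {n : ℕ} {p : ZMod 2} :
    O.adjoin.Op n p →ₗ[k] O.adjoin.Op n p :=
  O.leftProjRecursor.map

theorem leftProj_of {n : ℕ} {p : ZMod 2} (x : O.Op n p) : O.leftProj (O.adjoinOf x) = 0 := rfl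

theorem leftProj_gen : O.leftProj O.adjoinGen = O.adjoinGen := rfl

theorem leftProj_act {n : ℕ} {p : ZMod 2} (σ : Equiv.Perm (Fin n)) (x : O.adjoin.Op n p) :
    O.leftProj (O.adjoin.act σ x) = O.adjoin.act σ (O.leftProj x) :=
  O.leftProjRecursor.map_act σ x

theorem leftProj_comp {a b c : ℕ} {p q s : ZMod 2} (i : Fin a) (hc : a + b = c + 1)
    (hs : p + q = s) (x : O.adjoin.Op a p) (y : O.adjoin.Op b q) :
    O.leftProj (O.adjoin.comp i hc hs x y) = O.adjoin.comp i hc hs (O.leftProj x) y :=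
  O.leftProjRecursor.map_comp i hc hs x y

/-! ### Families indexed by the inputs, on which the right projections are defined simultaneously
because compositions and permutations relabel the inputs. -/

/-- The action of the symmetric groups on families of operations indexed by the inputs. -/
def actFamily (O : SuperOperad.{u, v} k) {n : ℕ} {p : ZMod 2} :
    Representation k (Equiv.Perm (Fin n)) (Fin n → O.Op n p) where
  toFun σ := LinearMap.pi fun l => O.act σ ∘ₗ LinearMap.proj (σ⁻¹ l)
  map_one' := by ext; simp
  map_mul' σ τ := by ext; simp [mul_inv_rev]

theorem actFamily_apply {n : ℕ} {p : ZMod 2} (σ : Equiv.Perm (Fin n)) (t : Fin n → O.Op n p)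
    (l : Fin n) : O.actFamily σ t (σ l) = O.act σ (t l) := by
  simp [actFamily]

/-- The family of the partial compositions of `x` with a family and of a family with `y`. -/
def compFamily (O : SuperOperad.{u, v} k) {a b c : ℕ} {p q s : ZMod 2} (i : Fin a)
    (hc : a + b = c + 1) (hs : p + q = s) (x : O.Op a p) (t : Fin a → O.Op a p) (y : O.Op b q)
    (u : Fin b → O.Op b q) (l : Fin c) : O.Op c s :=
  Sum.elim (fun j => O.comp i hc hs (t j.1) y) (fun j => O.comp i hc hs x (u j))
    ((insertEquiv hc i).symm l)

theorem compFamily_inl {a b c : ℕ} {p q s : ZMod 2} (i : Fin a)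
    (hc : a + b = c + 1) (hs : p + q = s) (x : O.Op a p) (t : Fin a → O.Op a p) (y : O.Op b q)
    (u : Fin b → O.Op b q) (j : {j : Fin a // j ≠ i}) :
    O.compFamily i hc hs x t y u (insertEquiv hc i (Sum.inl j)) = O.comp i hc hs (t j.1) y := by
  simp [compFamily]

theorem compFamily_inr {a b c : ℕ} {p q s : ZMod 2} (i : Fin a)
    (hc : a + b = c + 1) (hs : p + q = s) (x : O.Op a p) (t : Fin a → O.Op a p) (y : O.Op b q)
    (u : Fin b → O.Op b q) (j : Fin b) :
    O.compFamily i hc hs x t y u (insertEquiv hc i (Sum.inr j)) = O.comp i hc hs x (u j) := by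
  simp [compFamily]

theorem funext_insertEquiv {a b c : ℕ} (hc : a + b = c + 1) (i : Fin a) {T : Type w}
    {f g : Fin c → T} (hl : ∀ j, f (insertEquiv hc i (Sum.inl j)) = g (insertEquiv hc i (Sum.inl j)))
    (hr : ∀ j, f (insertEquiv hc i (Sum.inr j)) = g (insertEquiv hc i (Sum.inr j))) : f = g := by
  funext l
  obtain ⟨l | l, rfl⟩ := (insertEquiv hc i).surjective l
  exacts [hl l, hr l]

/-- Recursion data for the right projections. -/
def rightProjRecursor (O : SuperOperad.{u, v} k) :
    AdjoinRecursor O (fun n p => Fin n → O.adjoin.Op n p) where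
  act := O.adjoin.actFamily
  of := 0
  gen _ := O.adjoinGen
  comp i hc hs x t y u := O.adjoin.compFamily i hc hs x t y u
  comp_add_left i hc hs x x' t t' y u := by
    apply funext_insertEquiv hc i <;> intro j <;> simp [compFamily_inl, compFamily_inr]
  comp_smul_left i hc hs r x t y u := by
    apply funext_insertEquiv hc i <;> intro j <;> simp [compFamily_inl, compFamily_inr]
  comp_add_right i hc hs x t y y' u u' := by
    apply funext_insertEquiv hc i <;> intro j <;> simp [compFamily_inl, compFamily_inr]
  comp_smul_right i hc hs r x t y u := by
    apply funext_insertEquiv hc i <;> intro j <;> simp [compFamily_inl, compFamily_inr]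
  comp_act i hc hs σ τ x t y u := by
    funext l
    obtain ⟨l, rfl⟩ := (blockPerm hc i σ τ).surjective l
    obtain ⟨l | l, rfl⟩ := (insertEquiv hc i).surjective l
    · rw [actFamily_apply, blockPerm_apply, Sum.map_inl, compFamily_inl, compFamily_inl,
        actFamily_apply, O.adjoin.comp_act]
    · rw [actFamily_apply, blockPerm_apply, Sum.map_inr, compFamily_inr, compFamily_inr,
        actFamily_apply, O.adjoin.comp_act]
  comp_seq i j h₁ h₂ h₃ h₄ e₁ e₂ e₃ e₄ x x' y y' z z' := by
    apply funext_insertEquiv h₂ (insertEquiv h₁ i (Sum.inr j))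
    · rintro ⟨l, hl⟩
      obtain ⟨⟨l, hli⟩ | l, rfl⟩ := (insertEquiv h₁ i).surjective l
      · rw [compFamily_inl, compFamily_inl, insertEquiv_seq_inl i l j hli h₁ h₂ h₃ h₄,
          compFamily_inl, O.adjoin.comp_seq i j h₁ h₂ h₃ h₄ e₁ e₂ e₃ e₄]
      · have hlj : l ≠ j := by rintro rfl; exact hl rfl
        rw [compFamily_inl, compFamily_inr, insertEquiv_seq_mid i j l hlj h₁ h₂ h₃ h₄,
          compFamily_inr, compFamily_inl, O.adjoin.comp_seq i j h₁ h₂ h₃ h₄ e₁ e₂ e₃ e₄]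
    · intro l
      rw [compFamily_inr, insertEquiv_seq_inr i j l h₁ h₂ h₃ h₄, compFamily_inr,
        compFamily_inr, O.adjoin.comp_seq i j h₁ h₂ h₃ h₄ e₁ e₂ e₃ e₄]
  comp_par i j hij h₁ h₂ h₃ h₄ e₁ e₂ e₃ e₄ x x' y y' z z' := by
    apply funext_insertEquiv h₂ (insertEquiv h₁ i (Sum.inl ⟨j, hij⟩))
    · rintro ⟨l, hl⟩
      obtain ⟨⟨l, hli⟩ | l, rfl⟩ := (insertEquiv h₁ i).surjective l
      · have hlj : l ≠ j := by rintro rfl; exact hl rfl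
        rw [Pi.smul_apply, compFamily_inl, compFamily_inl,
          insertEquiv_par_inl i j l hij hli hlj h₁ h₂ h₃ h₄ hl (by simp [hli]),
          compFamily_inl, compFamily_inl, O.adjoin.comp_par i j hij h₁ h₂ h₃ h₄ e₁ e₂ e₃ e₄]
      · rw [Pi.smul_apply, compFamily_inl, compFamily_inr,
          -- An input of `y`: the lemma for inputs of `z`, with both insertions exchanged and read
          -- backwards.
          ← insertEquiv_par_inr j i hij.symm l h₃ h₄ h₁ h₂,
          compFamily_inr, O.adjoin.comp_par i j hij h₁ h₂ h₃ h₄ e₁ e₂ e₃ e₄]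
    · intro l
      rw [Pi.smul_apply, compFamily_inr, insertEquiv_par_inr i j hij l h₁ h₂ h₃ h₄ (by simp),
        compFamily_inl, compFamily_inr, O.adjoin.comp_par i j hij h₁ h₂ h₃ h₄ e₁ e₂ e₃ e₄]
  of_act σ x := by simp
  of_comp i hc hs x y := by
    apply funext_insertEquiv hc i <;> intro j <;> simp [compFamily_inl, compFamily_inr]

/-- The projection of `O[m]` onto the span of `m` and of the operations `x ∘_i m` that vanishes on
the operations with an operation of `O` at the input `i`. -/
def rightProj (O : SuperOperad.{u, v} k) {n : ℕ} {p : ZMod 2} (i : Fin n) :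
    O.adjoin.Op n p →ₗ[k] O.adjoin.Op n p :=
  LinearMap.proj i ∘ₗ O.rightProjRecursor.map

theorem rightProj_of {n : ℕ} {p : ZMod 2} (l : Fin n) (x : O.Op n p) :
    O.rightProj l (O.adjoinOf x) = 0 := rfl

theorem rightProj_gen (l : Fin 1) : O.rightProj l O.adjoinGen = O.adjoinGen := rfl

theorem rightProj_act {n : ℕ} {p : ZMod 2} (σ : Equiv.Perm (Fin n)) (l : Fin n)
    (x : O.adjoin.Op n p) :
    O.rightProj (σ l) (O.adjoin.act σ x) = O.adjoin.act σ (O.rightProj l x) :=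
  (congrFun (O.rightProjRecursor.map_act σ x) (σ l)).trans (actFamily_apply _ _ _)

theorem rightProj_comp_inl {a b c : ℕ} {p q s : ZMod 2} (i : Fin a) (hc : a + b = c + 1)
    (hs : p + q = s) (x : O.adjoin.Op a p) (y : O.adjoin.Op b q) (j : {j : Fin a // j ≠ i}) :
    O.rightProj (insertEquiv hc i (Sum.inl j)) (O.adjoin.comp i hc hs x y) =
      O.adjoin.comp i hc hs (O.rightProj j.1 x) y :=
  (congrFun (O.rightProjRecursor.map_comp i hc hs x y) _).trans (compFamily_inl ..)

theorem rightProj_comp_inr {a b c : ℕ} {p q s : ZMod 2} (i : Fin a) (hc : a + b = c + 1)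
    (hs : p + q = s) (x : O.adjoin.Op a p) (y : O.adjoin.Op b q) (j : Fin b) :
    O.rightProj (insertEquiv hc i (Sum.inr j)) (O.adjoin.comp i hc hs x y) =
      O.adjoin.comp i hc hs x (O.rightProj j y) :=
  (congrFun (O.rightProjRecursor.map_comp i hc hs x y) _).trans (compFamily_inr ..)

end SuperOperad

/-! ### Compatibility of `recast` with the operad structure. -/

namespace SuperOperad

variable {k : Type u} [Field k] {O : SuperOperad.{u, v} k}

theorem recast_of_ne {a : ℕ} {p t : ZMod 2} (h : p ≠ t) (x : O.Op a p) :
    (O.recast x : O.Op a t) = 0 := by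
  simp [recast, h]

theorem recast_act {a : ℕ} {p t : ZMod 2} (σ : Equiv.Perm (Fin a)) (x : O.Op a p) :
    (O.recast (O.act σ x) : O.Op a t) = O.act σ (O.recast x) := by
  by_cases h : p = t
  · subst h; rw [recast_self, recast_self]
  · rw [recast_of_ne h, recast_of_ne h, map_zero]

/-- By cancellation in `ZMod 2`, the parities disagree before composing exactly when they disagree
after, and then both sides are zero. -/
theorem recast_comp_left {a b c : ℕ} {p p' q s s' : ZMod 2} (i : Fin a) (hc : a + b = c + 1)
    (hs : p + q = s) (hs' : p' + q = s') (x : O.Op a p) (y : O.Op b q) :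
    O.comp i hc hs' (O.recast x) y = O.recast (O.comp i hc hs x y) := by
  subst hs hs'
  by_cases h : p = p'
  · subst h; rw [recast_self, recast_self]
  · rw [recast_of_ne h, recast_of_ne (fun e => h (add_right_cancel e)), map_zero,
      LinearMap.zero_apply]

theorem recast_comp_right {a b c : ℕ} {p q q' s s' : ZMod 2} (i : Fin a) (hc : a + b = c + 1)
    (hs : p + q = s) (hs' : p + q' = s') (x : O.Op a p) (y : O.Op b q) :
    O.comp i hc hs' x (O.recast y) = O.recast (O.comp i hc hs x y) := by
  subst hs hs'
  by_cases h : q = q'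
  · subst h; rw [recast_self, recast_self]
  · rw [recast_of_ne h, recast_of_ne (fun e => h (add_left_cancel e)), map_zero]

/-! ### The left derivative with respect to `m` -/

/-- Recursion data for the left derivative. -/
def leftDerivRecursor (O : SuperOperad.{u, v} k) :
    AdjoinRecursor O (fun n p => O.adjoin.Op n (p + 1)) where
  act := O.adjoin.act
  of := 0
  gen := 0
  -- The derivative acts at the root, hence on the first factor and without sign. The second term is
  -- the contribution of the component of `x` along `m`, whose derivative should be the unit.
  comp i hc hs x t y _ := O.adjoin.comp i hc (by rw [← hs, add_right_comm]) t y +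
    O.genCoeff x • O.adjoin.recast y
  comp_add_left := by intros; simp only [map_add, LinearMap.add_apply, add_smul]; abel
  comp_smul_left := by
    intros; simp only [map_smul, LinearMap.smul_apply, smul_add, smul_smul, smul_eq_mul]
  comp_add_right := by intros; simp only [map_add, smul_add]; abel
  comp_smul_right r := by intros; simp only [map_smul, smul_add, smul_comm (O.genCoeff _)]
  comp_act i hc hs σ τ x t y u := by
    rw [O.adjoin.comp_act, map_add, map_smul, genCoeff_act]
    congr 1
    rcases genCoeff_eq_zero_or x with h | ⟨rfl, rfl⟩
    · rw [h, zero_smul, zero_smul]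
    · obtain rfl := Nat.add_left_cancel (hc.trans (Nat.add_comm _ _))
      obtain rfl : i = 0 := Subsingleton.elim _ _
      rw [blockPerm_one_left, recast_act]
  comp_seq i j h₁ h₂ h₃ h₄ e₁ e₂ e₃ e₄ x x' y y' z z' := by
    rw [genCoeff_comp, zero_smul, add_zero, map_add, LinearMap.add_apply,
      O.adjoin.comp_seq i j h₁ h₂ h₃ h₄ _ _ e₃ (by rw [← e₄, add_right_comm]) x' y z, map_smul,
      LinearMap.smul_apply]
    congr 1
    rcases genCoeff_eq_zero_or x with h | ⟨rfl, rfl⟩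
    · rw [h, zero_smul, zero_smul]
    · obtain rfl := Nat.add_left_cancel (h₁.trans (Nat.add_comm _ _))
      obtain rfl := Nat.add_left_cancel (h₄.trans (Nat.add_comm _ _))
      obtain rfl : i = 0 := Subsingleton.elim _ _
      rw [insertEquiv_one_left, recast_comp_left j h₃ e₃]
  comp_par i j hij h₁ h₂ h₃ h₄ e₁ e₂ e₃ e₄ x x' y y' z z' := by
    -- If the coefficient of `m` in `x` is nonzero, `x` is unary and has no two distinct inputs.
    rcases genCoeff_eq_zero_or x with h | ⟨rfl, rfl⟩
    · rw [genCoeff_comp, genCoeff_comp, h, zero_smul, zero_smul, zero_smul, zero_smul, add_zero,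
        add_zero, add_zero, add_zero]
      apply O.adjoin.comp_par
    · exact absurd (Subsingleton.elim _ _) hij
  of_act := by simp
  of_comp := by simp [genCoeff_of]

/-- The left derivative of `O[m]`: it sends `m ∘_1 x` to `x`, and vanishes on `m` and on the
operations with an operation of `O` at the root. -/
def leftDeriv (O : SuperOperad.{u, v} k) {n : ℕ} {p q : ZMod 2} (_ : p + 1 = q) :
    O.adjoin.Op n p →ₗ[k] O.adjoin.Op n q :=
  O.adjoin.recast ∘ₗ O.leftDerivRecursor.map (p := p)

theorem leftDeriv_of {n : ℕ} {p q : ZMod 2} (h : p + 1 = q) (x : O.Op n p) :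
    O.leftDeriv h (O.adjoinOf x) = 0 := by
  rw [leftDeriv, LinearMap.comp_apply, AdjoinRecursor.map_of]
  exact map_zero _

/-- The value should be the unit, which `O[m]` lacks. Zero has the same differential as a unit, so
this choice does not disturb the homotopy identities. -/
theorem leftDeriv_gen {q : ZMod 2} (h : 1 + 1 = q) : O.leftDeriv h O.adjoinGen = 0 := by
  rw [leftDeriv, LinearMap.comp_apply, AdjoinRecursor.map_gen]
  exact map_zero _

theorem leftDeriv_act {n : ℕ} {p q : ZMod 2} (h : p + 1 = q) (σ : Equiv.Perm (Fin n))
    (x : O.adjoin.Op n p) :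
    O.leftDeriv h (O.adjoin.act σ x) = O.adjoin.act σ (O.leftDeriv h x) := by
  simp only [leftDeriv, LinearMap.comp_apply, AdjoinRecursor.map_act]
  exact recast_act σ _

theorem leftDeriv_comp {a b c : ℕ} {p p' q s t : ZMod 2} (i : Fin a) (hc : a + b = c + 1)
    (hs : p + q = s) (ht : s + 1 = t) (hp : p + 1 = p') (hp' : p' + q = t)
    (x : O.adjoin.Op a p) (y : O.adjoin.Op b q) :
    O.leftDeriv ht (O.adjoin.comp i hc hs x y) = O.adjoin.comp i hc hp' (O.leftDeriv hp x) y +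
      O.genCoeff x • O.adjoin.recast y := by
  subst hp hs ht
  simp only [leftDeriv, LinearMap.comp_apply, AdjoinRecursor.map_comp, recast_self]
  rfl

/-! ### Composition with the left derivative -/

/-- The composition `w ∘_i D y` with the left derivative `D y` of `y`, where `D m` is the unit. -/
def compDeriv (O : SuperOperad.{u, v} k) {a b c : ℕ} {p q q' t : ZMod 2} (i : Fin a)
    (hc : a + b = c + 1) (hq : q + 1 = q') (ht : p + q' = t) :
    O.adjoin.Op a p →ₗ[k] O.adjoin.Op b q →ₗ[k] O.adjoin.Op c t :=
  LinearMap.mk₂ k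
    (fun w y => O.adjoin.comp i hc ht w (O.leftDeriv hq y) + O.genCoeff y • O.adjoin.recast w)
    (fun w w' y => by simp only [map_add, LinearMap.add_apply, smul_add]; abel)
    (fun r w y => by simp only [map_smul, LinearMap.smul_apply, smul_add, smul_comm (O.genCoeff _)])
    (fun w y y' => by simp only [map_add, add_smul]; abel)
    (fun r w y => by simp only [map_smul, smul_add, smul_smul, smul_eq_mul])

theorem compDeriv_apply {a b c : ℕ} {p q q' t : ZMod 2} (i : Fin a)
    (hc : a + b = c + 1) (hq : q + 1 = q') (ht : p + q' = t)
    (w : O.adjoin.Op a p) (y : O.adjoin.Op b q) :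
    O.compDeriv i hc hq ht w y =
      O.adjoin.comp i hc ht w (O.leftDeriv hq y) + O.genCoeff y • O.adjoin.recast w := rfl

theorem compDeriv_of {a b c : ℕ} {p q q' t : ZMod 2} (i : Fin a)
    (hc : a + b = c + 1) (hq : q + 1 = q') (ht : p + q' = t)
    (w : O.adjoin.Op a p) (y : O.Op b q) : O.compDeriv i hc hq ht w (O.adjoinOf y) = 0 := by
  rw [compDeriv_apply, leftDeriv_of, genCoeff_of, map_zero, zero_smul, add_zero]

theorem compDeriv_act {a b c : ℕ} {p q q' t : ZMod 2} (i : Fin a)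
    (hc : a + b = c + 1) (hq : q + 1 = q') (ht : p + q' = t) (σ : Equiv.Perm (Fin a))
    (τ : Equiv.Perm (Fin b)) (w : O.adjoin.Op a p) (y : O.adjoin.Op b q) :
    O.compDeriv (σ i) hc hq ht (O.adjoin.act σ w) (O.adjoin.act τ y) =
      O.adjoin.act (blockPerm hc i σ τ) (O.compDeriv i hc hq ht w y) := by
  rw [compDeriv_apply, compDeriv_apply, leftDeriv_act, genCoeff_act, O.adjoin.comp_act, map_add,
    map_smul]
  congr 1
  rcases genCoeff_eq_zero_or y with h | ⟨rfl, rfl⟩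
  · rw [h, zero_smul, zero_smul]
  · obtain rfl := Nat.add_right_cancel hc
    obtain rfl : τ = 1 := Subsingleton.elim _ _
    rw [blockPerm_one_right, recast_act]

/-- This lemma and the next two are the operad axioms with one factor differentiated. The terms
without `genCoeff` are literal instances of the axioms; the others express that the virtual unit `D
m` is neutral. -/
theorem compDeriv_comp_left {a b c ab bc r : ℕ} {p q s s' pq qs t : ZMod 2} (i : Fin a) (j : Fin b)
    (h₁ : a + b = ab + 1) (h₂ : ab + c = r + 1) (h₃ : b + c = bc + 1) (h₄ : a + bc = r + 1)
    (hs : s + 1 = s') (e₁ : p + q = pq) (e₂ : pq + s' = t) (e₃ : q + s' = qs) (e₄ : p + qs = t)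
    (w : O.adjoin.Op a p) (y : O.adjoin.Op b q) (z : O.adjoin.Op c s) :
    O.compDeriv (insertEquiv h₁ i (Sum.inr j)) h₂ hs e₂ (O.adjoin.comp i h₁ e₁ w y) z =
      O.adjoin.comp i h₄ e₄ w (O.compDeriv j h₃ hs e₃ y z) := by
  rw [compDeriv_apply, compDeriv_apply, map_add, map_smul,
    O.adjoin.comp_seq i j h₁ h₂ h₃ h₄ e₁ e₂ e₃ e₄]
  congr 1
  rcases genCoeff_eq_zero_or z with h | ⟨rfl, rfl⟩
  · rw [h, zero_smul, zero_smul]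
  · obtain rfl := Nat.add_right_cancel h₂
    obtain rfl := Nat.add_right_cancel h₃
    rw [recast_comp_right i h₁ e₁]

theorem compDeriv_comp_right {a b c ab bc r : ℕ} {p q q' s pq qs qs' t : ZMod 2} (i : Fin a)
    (j : Fin b) (h₁ : a + b = ab + 1) (h₂ : ab + c = r + 1) (h₃ : b + c = bc + 1)
    (h₄ : a + bc = r + 1) (hq : q + 1 = q') (e₁ : p + q' = pq) (e₂ : pq + s = t)
    (e₃ : q + s = qs) (hqs : qs + 1 = qs') (e₄ : p + qs' = t)
    (w : O.adjoin.Op a p) (y : O.adjoin.Op b q) (z : O.adjoin.Op c s) :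
    O.compDeriv i h₄ hqs e₄ w (O.adjoin.comp j h₃ e₃ y z) =
      O.adjoin.comp (insertEquiv h₁ i (Sum.inr j)) h₂ e₂ (O.compDeriv i h₁ hq e₁ w y) z := by
  have e : q' + s = qs' := by rw [← hqs, ← e₃, ← hq, add_right_comm]
  rw [compDeriv_apply, compDeriv_apply, genCoeff_comp, zero_smul, add_zero,
    leftDeriv_comp j h₃ e₃ hqs hq e, map_add, map_smul, map_add, map_smul, LinearMap.add_apply,
    LinearMap.smul_apply, O.adjoin.comp_seq i j h₁ h₂ h₃ h₄ e₁ e₂ e e₄]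
  congr 1
  rcases genCoeff_eq_zero_or y with h | ⟨rfl, rfl⟩
  · rw [h, zero_smul, zero_smul]
  · obtain rfl := Nat.add_right_cancel h₁
    obtain rfl := Nat.add_left_cancel (h₃.trans (Nat.add_comm _ _))
    rw [insertEquiv_one_right_inr, recast_comp_right i h₄ rfl, recast_comp_left i h₄ rfl]

theorem compDeriv_comp_par {a b c ab ac r : ℕ} {p q q' s pq ps t : ZMod 2} (i j : Fin a)
    (hij : j ≠ i) (h₁ : a + b = ab + 1) (h₂ : ab + c = r + 1) (h₃ : a + c = ac + 1)
    (h₄ : ac + b = r + 1) (hq : q + 1 = q') (e₁ : p + q' = pq) (e₂ : pq + s = t)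
    (e₃ : p + s = ps) (e₄ : ps + q' = t)
    (w : O.adjoin.Op a p) (y : O.adjoin.Op b q) (z : O.adjoin.Op c s) :
    O.adjoin.comp (insertEquiv h₁ i (Sum.inl ⟨j, hij⟩)) h₂ e₂ (O.compDeriv i h₁ hq e₁ w y) z =
      paritySign k (q' * s) • O.compDeriv (insertEquiv h₃ j (Sum.inl ⟨i, hij.symm⟩)) h₄ hq e₄
        (O.adjoin.comp j h₃ e₃ w z) y := by
  rw [compDeriv_apply, compDeriv_apply, map_add, LinearMap.add_apply, smul_add, map_smul,
    LinearMap.smul_apply, O.adjoin.comp_par i j hij h₁ h₂ h₃ h₄ e₁ e₂ e₃ e₄]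
  congr 1
  rcases genCoeff_eq_zero_or y with h | ⟨rfl, rfl⟩
  · rw [h, zero_smul, zero_smul, smul_zero]
  · obtain rfl := Nat.add_right_cancel h₁
    obtain rfl := Nat.add_right_cancel h₄
    obtain rfl : q' = 0 := hq.symm
    rw [insertEquiv_one_right_inl, zero_mul, paritySign_zero, one_smul,
      recast_comp_left j h₃ e₃]

/-! ### The contraction of the strings of copies of `m` above the root -/

/-- Recursion data for the contraction of the strings of copies of `m` above the root. -/
def upperContractionRecursor (O : SuperOperad.{u, v} k) :
    AdjoinRecursor O (fun n p => O.adjoin.Op n (p + 1)) where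
  act := O.adjoin.act
  of := 0
  gen := 0
  -- The edges of `x ∘_i y` above the root are those of `x`, those of `y` and the joining edge. If
  -- `x` ends with a string at the input `i`, the joining edge is already accounted for by the root
  -- or the upper edges of `x`, so only `x - rightProj i x` composes with the derivative of `y`. The
  -- odd operator passes `x` with the sign of its parity.
  comp {a b c p q s} i hc hs x t y u :=
    O.adjoin.comp i hc (by rw [← hs, add_right_comm]) t y + paritySign k p •
      (O.compDeriv i hc rfl (by rw [← hs, add_assoc]) (x - O.rightProj i x) y +
        O.adjoin.comp i hc (by rw [← hs, add_assoc]) x u)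
  comp_add_left := by
    intros; simp only [map_add, LinearMap.add_apply, smul_add, map_sub, LinearMap.sub_apply]
    module
  comp_smul_left := by
    intros; simp only [map_smul, LinearMap.smul_apply, smul_add, map_sub, LinearMap.sub_apply]
    module
  comp_add_right := by
    intros; simp only [map_add]
    module
  comp_smul_right r := by
    intros; simp only [map_smul]
    module
  comp_act i hc hs σ τ x t y u := by
    rw [rightProj_act, ← map_sub, O.adjoin.comp_act, O.adjoin.comp_act, compDeriv_act]
    simp only [map_add, map_smul]
  comp_seq {a b c ab bc r p q s pq qs t} i j h₁ h₂ h₃ h₄ e₁ e₂ e₃ e₄ x x' y y' z z' := by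
    subst e₁ e₃ e₂
    rw [rightProj_comp_inr, ← map_sub,
      compDeriv_comp_left i j h₁ h₂ h₃ h₄ rfl rfl _ (by ring : q + (s + 1) = q + s + 1) (by ring),
      compDeriv_comp_right i j h₁ h₂ h₃ h₄ rfl (by ring : p + (q + 1) = p + q + 1) (by ring) rfl
        rfl,
      O.adjoin.comp_seq i j h₁ h₂ h₃ h₄ rfl _ (by ring : q + (s + 1) = q + s + 1) (by ring) x y z']
    simp only [map_add, map_smul, LinearMap.add_apply, LinearMap.smul_apply]
    rw [O.adjoin.comp_seq i j h₁ h₂ h₃ h₄ _ _ rfl (by ring) x' y z,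
      O.adjoin.comp_seq i j h₁ h₂ h₃ h₄ _ _ (by ring : q + 1 + s = q + s + 1) (by ring) x y' z,
      paritySign_add]
    module
  comp_par {a b c ab ac r p q s pq ps t} i j hij h₁ h₂ h₃ h₄ e₁ e₂ e₃ e₄ x x' y y' z z' := by
    subst e₁ e₃ e₂
    -- The exchange sign of two parallel factors when the contraction has changed the parity of one
    -- of them, combined with the sign for passing the factors before it.
    have c₁ : paritySign k p * paritySign k ((q + 1) * s) =
        paritySign k (q * s) * (paritySign k p * paritySign k s) := by
      rw [add_mul, one_mul, paritySign_add]; ring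
    have c₂ : paritySign k (q * s) * (paritySign k p * paritySign k ((s + 1) * q)) =
        paritySign k p * paritySign k q := by
      rw [add_mul, one_mul, paritySign_add, mul_comm s q]
      linear_combination (paritySign k p * paritySign k q) * paritySign_mul_self k (q * s)
    have c₃ : paritySign k p * paritySign k q * paritySign k (q * (s + 1)) =
        paritySign k (q * s) * paritySign k p := by
      rw [mul_add, mul_one, paritySign_add]
      linear_combination (paritySign k (q * s) * paritySign k p) * paritySign_mul_self k q
    -- A composition at another input does not affect whether `x` ends with a string at the given
    -- one.
    rw [rightProj_comp_inl, rightProj_comp_inl, ← LinearMap.sub_apply, ← LinearMap.sub_apply,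
      ← map_sub, ← map_sub]
    simp only [map_add, map_smul, LinearMap.add_apply, LinearMap.smul_apply]
    rw [O.adjoin.comp_par i j hij h₁ h₂ h₃ h₄ _ _ (by ring : p + 1 + s = p + s + 1)
        (by rw [← e₄]; ring) x' y z,
      O.adjoin.comp_par i j hij h₁ h₂ h₃ h₄ _ _ rfl (by rw [← e₄]; ring) x y' z,
      O.adjoin.comp_par i j hij h₁ h₂ h₃ h₄ _ _ (by ring : p + (s + 1) = p + s + 1)
        (by rw [← e₄]; ring) x y z',
      compDeriv_comp_par i j hij h₁ h₂ h₃ h₄ rfl _ _ rfl (by rw [← e₄]; ring),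
      compDeriv_comp_par j i hij.symm h₃ h₄ h₁ h₂ rfl _ _ rfl (by ring), paritySign_add k p q,
      paritySign_add k p s]
    simp only [smul_add, smul_smul, c₁, c₂, c₃]
    abel
  of_act := by simp
  of_comp := by simp [compDeriv_of, rightProj_of]

/-- The contraction of the strings of copies of `m` above the root: on each edge of a tree of
operations of `O`, except for the root, it replaces `m ^ (j + 1)` by `m ^ j`, with a sign. -/
def upperContraction (O : SuperOperad.{u, v} k) {n : ℕ} {p q : ZMod 2} (_ : p + 1 = q) :
    O.adjoin.Op n p →ₗ[k] O.adjoin.Op n q :=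
  O.adjoin.recast ∘ₗ O.upperContractionRecursor.map (p := p)

theorem upperContraction_of {n : ℕ} {p q : ZMod 2} (h : p + 1 = q) (x : O.Op n p) :
    O.upperContraction h (O.adjoinOf x) = 0 := by
  rw [upperContraction, LinearMap.comp_apply, AdjoinRecursor.map_of]
  exact map_zero _

theorem upperContraction_gen {q : ZMod 2} (h : 1 + 1 = q) :
    O.upperContraction h O.adjoinGen = 0 := by
  rw [upperContraction, LinearMap.comp_apply, AdjoinRecursor.map_gen]
  exact map_zero _

theorem upperContraction_act {n : ℕ} {p q : ZMod 2} (h : p + 1 = q) (σ : Equiv.Perm (Fin n))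
    (x : O.adjoin.Op n p) :
    O.upperContraction h (O.adjoin.act σ x) = O.adjoin.act σ (O.upperContraction h x) := by
  simp only [upperContraction, LinearMap.comp_apply, AdjoinRecursor.map_act]
  exact recast_act σ _

theorem upperContraction_comp {a b c : ℕ} {p p' q q' s t : ZMod 2} (i : Fin a) (hc : a + b = c + 1)
    (hs : p + q = s) (ht : s + 1 = t) (hp : p + 1 = p') (hp' : p' + q = t) (hq : q + 1 = q')
    (hq' : p + q' = t) (x : O.adjoin.Op a p) (y : O.adjoin.Op b q) :
    O.upperContraction ht (O.adjoin.comp i hc hs x y) =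
      O.adjoin.comp i hc hp' (O.upperContraction hp x) y + paritySign k p •
        (O.compDeriv i hc hq hq' (x - O.rightProj i x) y +
          O.adjoin.comp i hc hq' x (O.upperContraction hq y)) := by
  subst hp hq hs ht
  simp only [upperContraction, LinearMap.comp_apply, AdjoinRecursor.map_comp, recast_self]
  rfl

end SuperOperad

namespace DGOperad

open SuperOperad

variable {k : Type u} [Field k] {O : DGOperad.{u, v} k}

/-! ### Anticommutation with the differential -/

theorem adjoinDiff_of {n : ℕ} {p q : ZMod 2} (h : p + 1 = q) (x : O.Op n p) :
    O.adjoinDiff h (O.adjoinOf x) = O.adjoinOf (O.d h x) := rfl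

theorem adjoinDiff_gen {q : ZMod 2} (h : 1 + 1 = q) :
    O.adjoinDiff h O.adjoinGen = -O.toSuperOperad.adjoin.comp 0 rfl h O.adjoinGen O.adjoinGen := rfl

theorem adjoinDiff_adjoinDiff {n : ℕ} {p q s : ZMod 2} (h : p + 1 = q) (h' : q + 1 = s)
    (x : O.toSuperOperad.adjoin.Op n p) : O.adjoinDiff h' (O.adjoinDiff h x) = 0 :=
  O.adjoin.d_d h h' x

theorem adjoinDiff_recast {a : ℕ} {p q s t : ZMod 2} (h : p + 1 = q) (h' : s + 1 = t)
    (x : O.toSuperOperad.adjoin.Op a p) :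
    O.adjoinDiff h' (O.toSuperOperad.adjoin.recast x : O.toSuperOperad.adjoin.Op a s) =
      O.toSuperOperad.adjoin.recast (O.adjoinDiff h x) := by
  subst h h'
  by_cases e : p = s
  · subst e; rw [recast_self, recast_self]
  · rw [recast_of_ne e, recast_of_ne (fun e' => e (add_right_cancel e')), map_zero]

/-- The relation `d m = -m²` survives when `m` is sent to zero, so the retraction is a chain map. -/
theorem adjoinRetract_adjoinDiff {n : ℕ} {p q : ZMod 2} (h : p + 1 = q)
    (x : O.toSuperOperad.adjoin.Op n p) :
    O.adjoinRetract (O.adjoinDiff h x) = O.d h (O.adjoinRetract x) := by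
  induction x using adjoin_induction generalizing q with
  | of x => rfl
  | gen =>
    rw [adjoinDiff_gen, map_neg, adjoinRetract_comp, adjoinRetract_gen, map_zero, map_zero,
      neg_zero]
  | zero => simp only [map_zero]
  | add x y hx hy => simp only [map_add, hx, hy]
  | smul r x hx => simp only [map_smul, hx]
  | act σ x hx => rw [adjoinDiff_act, adjoinRetract_act, adjoinRetract_act, hx, O.d_act]
  | @comp a b c p' q' s i hc hs x y hx hy =>
    have e₁ : p' + 1 + q' = q := by rw [← h, ← hs]; ring
    have e₂ : p' + (q' + 1) = q := by rw [← h, ← hs]; ring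
    rw [adjoinDiff_comp i hc hs h rfl e₁ rfl e₂, adjoinRetract_comp, O.d_comp i hc hs h rfl e₁ rfl e₂,
      map_add, map_smul, adjoinRetract_comp, adjoinRetract_comp, hx, hy]

/-- The differential never produces a bare `m`: it preserves `O`, sends `m` to a composite, and
sends composites to sums of composites. -/
theorem genCoeff_adjoinDiff {n : ℕ} {p q : ZMod 2} (h : p + 1 = q)
    (x : O.toSuperOperad.adjoin.Op n p) : O.genCoeff (O.adjoinDiff h x) = 0 := by
  induction x using adjoin_induction generalizing q with
  | of x => rfl
  | gen => rw [adjoinDiff_gen, map_neg, genCoeff_comp, neg_zero]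
  | zero => simp only [map_zero]
  | add x y hx hy => rw [map_add, map_add, hx, hy, add_zero]
  | smul r x hx => rw [map_smul, map_smul, hx, smul_zero]
  | act σ x hx => rw [adjoinDiff_act, genCoeff_act, hx]
  | @comp a b c p' q' s i hc hs x y hx hy =>
    rw [adjoinDiff_comp i hc hs h rfl (by rw [← h, ← hs]; ring) rfl (by rw [← h, ← hs]; ring),
      map_add, map_smul, genCoeff_comp, genCoeff_comp, smul_zero, add_zero]

/-- The homotopy on the root edge: `dD + Dd` is `-1` on a nonempty root string and `0` on an empty
one. The basic case is `D(d m) = -D(m²) = -m`; the Leibniz rule propagates it. -/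
theorem adjoinDiff_leftDeriv {n : ℕ} {p q : ZMod 2} (h : p + 1 = q) (h' : q + 1 = p)
    (x : O.toSuperOperad.adjoin.Op n p) :
    O.adjoinDiff h' (O.leftDeriv h x) = -O.leftProj x - O.leftDeriv h' (O.adjoinDiff h x) := by
  induction x using adjoin_induction generalizing q with
  | of x => rw [leftDeriv_of, leftProj_of, adjoinDiff_of, leftDeriv_of]; simp
  | gen =>
    rw [leftDeriv_gen, leftProj_gen, adjoinDiff_gen, map_neg,
      leftDeriv_comp 0 rfl h h' rfl (by decide), leftDeriv_gen, genCoeff_gen,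
      recast_self]
    simp
  | zero => simp
  | add x y hx hy => simp only [map_add, hx h h', hy h h']; abel
  | smul r x hx => simp only [map_smul, hx h h']; module
  | act σ x hx =>
    rw [leftDeriv_act, adjoinDiff_act, adjoinDiff_act, leftDeriv_act, leftProj_act, hx h h']
    simp only [map_sub, map_neg]
  | @comp a b c p₁ p₂ s i hc hs x y hx hy =>
    have e₁ : p₁ + 1 + p₂ = q := by rw [← h, ← hs]; ring
    have e₂ : p₁ + (p₂ + 1) = q := by rw [← h, ← hs]; ring
    have e₃ : p₁ + 1 + 1 = p₁ := parity_add_one_add_one _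
    have e₄ : p₁ + 1 + (p₂ + 1) = s := by
      rw [← h', ← h, ← hs]; ring
    rw [leftDeriv_comp i hc hs h rfl e₁, map_add, map_smul,
      adjoinDiff_comp i hc e₁ h' e₃ hs rfl e₄, hx rfl e₃, leftProj_comp,
      adjoinDiff_comp i hc hs h rfl e₁ rfl e₂, map_add, map_smul,
      leftDeriv_comp i hc e₁ h' e₃ hs, leftDeriv_comp i hc e₂ h' rfl e₄, genCoeff_adjoinDiff,
      zero_smul, add_zero, paritySign_add, paritySign_one]
    -- The virtual unit terms cancel because a nonzero coefficient forces `p₁ = 1`, hence sign `-1`.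
    have key : O.genCoeff x • O.adjoinDiff h'
        (O.toSuperOperad.adjoin.recast y : O.toSuperOperad.adjoin.Op c q) =
        - (paritySign k p₁ • O.genCoeff x • O.toSuperOperad.adjoin.recast (O.adjoinDiff rfl y)) := by
      rcases genCoeff_eq_zero_or x with e | ⟨rfl, rfl⟩
      · simp [e]
      · obtain rfl := Nat.add_left_cancel (hc.trans (Nat.add_comm _ _))
        rw [paritySign_one, adjoinDiff_recast rfl]
        module
    rw [key]
    simp only [map_sub, map_neg, LinearMap.sub_apply, LinearMap.neg_apply]
    module

/-- The left projection is the composition of the left derivative with `m`. -/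
theorem leftMul_leftDeriv {n : ℕ} {p q : ZMod 2} (h : p + 1 = q) (h' : 1 + q = p)
    (x : O.toSuperOperad.adjoin.Op n p) :
    O.toSuperOperad.adjoin.leftMul h' O.adjoinGen (O.leftDeriv h x) +
      O.genCoeff x • O.toSuperOperad.adjoin.recast O.adjoinGen = O.leftProj x := by
  induction x using adjoin_induction generalizing q with
  | of x => rw [leftDeriv_of, leftProj_of, genCoeff_of]; simp
  | gen => rw [leftDeriv_gen, leftProj_gen, genCoeff_gen, recast_self]; simp
  | zero => simp
  | add x y hx hy => rw [map_add, map_add, map_add, map_add, ← hx h h', ← hy h h']; module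
  | smul r x hx => rw [map_smul, map_smul, map_smul, map_smul, ← hx h h']; module
  | @act n p σ x hx =>
    rw [leftDeriv_act, leftMul_act, leftProj_act, genCoeff_act, ← hx h h', map_add, map_smul]
    congr 1
    rcases genCoeff_eq_zero_or x with e | ⟨rfl, rfl⟩
    · rw [e, zero_smul, zero_smul]
    · obtain rfl : σ = 1 := Subsingleton.elim _ _
      rw [map_one, Module.End.one_apply]
  | @comp a b c p₁ p₂ s i hc hs x y hx hy =>
    have e₁ : p₁ + 1 + p₂ = q := by rw [← h, ← hs]; ring
    have e₂ : 1 + (p₁ + 1) = p₁ := by rw [add_comm, parity_add_one_add_one]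
    rw [leftDeriv_comp i hc hs h rfl e₁, genCoeff_comp, zero_smul, add_zero, map_add, map_smul,
      leftMul_comp _ i hc e₁ h' e₂ hs, leftProj_comp, ← hx rfl e₂, map_add, LinearMap.add_apply,
      map_smul, LinearMap.smul_apply]
    congr 1
    rcases genCoeff_eq_zero_or x with e | ⟨rfl, rfl⟩
    · rw [e, zero_smul, zero_smul]
    · obtain rfl := Nat.add_left_cancel (hc.trans (Nat.add_comm _ _))
      obtain rfl : i = 0 := Subsingleton.elim _ _
      obtain rfl : p₂ = q := by rw [← h, ← hs, add_comm, ← add_assoc, one_add_one_parity, zero_add]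
      rw [recast_self, recast_self]
      rfl

/-- The differential lengthens strings but neither creates one on an empty edge nor empties one, so
ending with a string at `l` is preserved. -/
theorem rightProj_adjoinDiff {n : ℕ} {p q : ZMod 2} (h : p + 1 = q)
    (x : O.toSuperOperad.adjoin.Op n p) (l : Fin n) :
    O.rightProj l (O.adjoinDiff h x) = O.adjoinDiff h (O.rightProj l x) := by
  induction x using adjoin_induction generalizing q with
  | of x => rw [adjoinDiff_of, rightProj_of, rightProj_of, map_zero]
  | gen =>
    -- The only input of `m²` is written as the input of its upper factor.
    obtain rfl := Subsingleton.elim l ((insertEquiv (rfl : 1 + 1 = 1 + 1) 0) (Sum.inr 0))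
    rw [adjoinDiff_gen, map_neg, rightProj_comp_inr, rightProj_gen, rightProj_gen, adjoinDiff_gen]
  | zero => simp
  | add x y hx hy => simp only [map_add, hx, hy]
  | smul r x hx => simp only [map_smul, hx]
  | act σ x hx =>
    obtain ⟨l, rfl⟩ := σ.surjective l
    rw [adjoinDiff_act, rightProj_act, rightProj_act, adjoinDiff_act, hx]
  | @comp a b c p₁ p₂ s i hc hs x y hx hy =>
    have e₁ : p₁ + 1 + p₂ = q := by rw [← h, ← hs]; ring
    have e₂ : p₁ + (p₂ + 1) = q := by rw [← h, ← hs]; ring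
    obtain ⟨l | l, rfl⟩ := (insertEquiv hc i).surjective l
    · rw [adjoinDiff_comp i hc hs h rfl e₁ rfl e₂, map_add, map_smul, rightProj_comp_inl,
        rightProj_comp_inl, rightProj_comp_inl, adjoinDiff_comp i hc hs h rfl e₁ rfl e₂, hx]
    · rw [adjoinDiff_comp i hc hs h rfl e₁ rfl e₂, map_add, map_smul, rightProj_comp_inr,
        rightProj_comp_inr, rightProj_comp_inr, adjoinDiff_comp i hc hs h rfl e₁ rfl e₂, hy]

/-- The Leibniz rule for `w ∘_i D y`, with `d(D y)` replaced by `-leftProj y - D(d y)`; the virtual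
unit is a cycle. -/
theorem adjoinDiff_compDeriv {a b c : ℕ} {p p' q q' s t : ZMod 2} (i : Fin a) (hc : a + b = c + 1)
    (hq : q + 1 = q') (hs : p + q' = s) (ht : s + 1 = t) (hp : p + 1 = p') (hp' : p' + q' = t)
    (hq' : q' + 1 = q) (e : p + q = t)
    (w : O.toSuperOperad.adjoin.Op a p) (y : O.toSuperOperad.adjoin.Op b q) :
    O.adjoinDiff ht (O.compDeriv i hc hq hs w y) =
      O.compDeriv i hc hq hp' (O.adjoinDiff hp w) y -
        paritySign k p • (O.toSuperOperad.adjoin.comp i hc e w (O.leftProj y) +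
          O.compDeriv i hc hq' e w (O.adjoinDiff hq y)) := by
  rw [compDeriv_apply, compDeriv_apply, compDeriv_apply, genCoeff_adjoinDiff, zero_smul, add_zero,
    map_add, adjoinDiff_comp i hc hs ht hp hp' hq' e, adjoinDiff_leftDeriv, map_smul]
  have key : O.genCoeff y • O.adjoinDiff ht
      (O.toSuperOperad.adjoin.recast w : O.toSuperOperad.adjoin.Op c s) =
      O.genCoeff y • O.toSuperOperad.adjoin.recast (O.adjoinDiff hp w) := by
    rcases genCoeff_eq_zero_or y with e | ⟨rfl, rfl⟩
    · rw [e, zero_smul, zero_smul]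
    · obtain rfl := Nat.add_right_cancel hc
      rw [adjoinDiff_recast hp]
  rw [key, map_sub, map_neg]
  module

/-! ### The number of strings of copies of `m` above the root -/

/-- The operator that multiplies a tree of operations of `O` and strings of copies of `m` by the
number of its strings above the root. -/
def upperCount (O : DGOperad.{u, v} k) {n : ℕ} {p : ZMod 2} :
    O.toSuperOperad.adjoin.Op n p →ₗ[k] O.toSuperOperad.adjoin.Op n p :=
  -(O.upperContraction (parity_add_one_add_one p) ∘ₗ O.adjoinDiff rfl +
    O.adjoinDiff (parity_add_one_add_one p) ∘ₗ O.upperContraction rfl)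

theorem upperCount_apply {n : ℕ} {p q : ZMod 2} (h : p + 1 = q) (h' : q + 1 = p)
    (x : O.toSuperOperad.adjoin.Op n p) :
    O.upperCount x =
      -(O.upperContraction h' (O.adjoinDiff h x) + O.adjoinDiff h' (O.upperContraction h x)) := by
  subst h
  rfl

theorem upperCount_of {n : ℕ} {p : ZMod 2} (x : O.Op n p) : O.upperCount (O.adjoinOf x) = 0 := by
  rw [upperCount_apply rfl (parity_add_one_add_one p), upperContraction_of, adjoinDiff_of,
    upperContraction_of, map_zero, add_zero, neg_zero]

theorem upperCount_act {n : ℕ} {p : ZMod 2} (σ : Equiv.Perm (Fin n))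
    (x : O.toSuperOperad.adjoin.Op n p) :
    O.upperCount (O.toSuperOperad.adjoin.act σ x) =
      O.toSuperOperad.adjoin.act σ (O.upperCount x) := by
  rw [upperCount_apply rfl (parity_add_one_add_one p),
    upperCount_apply rfl (parity_add_one_add_one p), upperContraction_act, adjoinDiff_act,
    upperContraction_act, adjoinDiff_act, map_neg, map_add]

/-- The anticommutator of two odd operators obeying Leibniz rules is a derivation. The extra term of
`upperContraction` on the joining edge adds one contribution, through `dD + Dd = -leftProj`: a root
string of `y` becomes a new string above the root unless it merges with a string at the end of `x`.
-/
theorem upperCount_comp {a b c : ℕ} {p q s : ZMod 2} (i : Fin a) (hc : a + b = c + 1)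
    (hs : p + q = s) (x : O.toSuperOperad.adjoin.Op a p) (y : O.toSuperOperad.adjoin.Op b q) :
    O.upperCount (O.toSuperOperad.adjoin.comp i hc hs x y) =
      O.toSuperOperad.adjoin.comp i hc hs (O.upperCount x) y +
        O.toSuperOperad.adjoin.comp i hc hs (x - O.rightProj i x) (O.leftProj y) +
        O.toSuperOperad.adjoin.comp i hc hs x (O.upperCount y) := by
  have hp := parity_add_one_add_one p
  have hq := parity_add_one_add_one q
  have e₁ : p + 1 + q = s + 1 := by rw [← hs]; ring
  have e₂ : p + (q + 1) = s + 1 := by rw [← hs]; ring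
  have e₃ : p + 1 + (q + 1) = s := by rw [← hs, ← parity_add_one_add_one (p + q)]; ring
  have e₄ := parity_add_one_add_one s
  rw [upperCount_apply rfl e₄, upperCount_apply rfl hp, upperCount_apply rfl hq,
    adjoinDiff_comp i hc hs rfl rfl e₁ rfl e₂, map_add, map_smul,
    upperContraction_comp i hc e₁ e₄ hp hs rfl e₃, upperContraction_comp i hc e₂ e₄ rfl e₃ hq hs,
    upperContraction_comp i hc hs rfl rfl e₁ rfl e₂, map_add, map_smul, map_add,
    adjoinDiff_comp i hc e₁ e₄ hp hs rfl e₃, adjoinDiff_comp i hc e₂ e₄ rfl e₃ hq hs,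
    adjoinDiff_compDeriv i hc rfl e₂ e₄ rfl e₃ hq hs, map_sub (O.adjoinDiff rfl),
    rightProj_adjoinDiff, paritySign_add, paritySign_one]
  have e₅ := paritySign_mul_self k p
  simp only [map_neg, map_add, map_sub, LinearMap.add_apply, LinearMap.sub_apply,
    LinearMap.neg_apply, smul_add, smul_sub, smul_smul, e₅, mul_neg, mul_one, neg_smul, one_smul]
  abel

/-- The string `m` lies on the root edge; `m - rightProj m = 0` removes the joining term in the
contraction of `m²`. -/
theorem upperCount_gen : O.upperCount O.adjoinGen = 0 := by
  rw [upperCount_apply rfl (by decide : (1 : ZMod 2) + 1 + 1 = 1), upperContraction_gen, map_zero,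
    adjoinDiff_gen, map_neg, upperContraction_comp 0 rfl rfl (by decide) rfl (by decide) rfl
    (by decide), upperContraction_gen, rightProj_gen]
  simp

end DGOperad

namespace DGOperad

open SuperOperad Polynomial

variable {k : Type u} [Field k] {O : DGOperad.{u, v} k}

/-! ### Decomposition by the number of strings of copies of `m` -/

/-- The operator that multiplies a tree of operations of `O` and strings of copies of `m` by the
number of its strings. -/
def stringCount (O : DGOperad.{u, v} k) {n : ℕ} {p : ZMod 2} :
    O.toSuperOperad.adjoin.Op n p →ₗ[k] O.toSuperOperad.adjoin.Op n p :=
  O.upperCount + O.leftProj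

theorem stringCount_of {n : ℕ} {p : ZMod 2} (x : O.Op n p) : O.stringCount (O.adjoinOf x) = 0 := by
  rw [stringCount, LinearMap.add_apply, upperCount_of, leftProj_of, add_zero]

theorem stringCount_apply {n : ℕ} {p q : ZMod 2} (h : p + 1 = q) (h' : q + 1 = p)
    (x : O.toSuperOperad.adjoin.Op n p) :
    O.stringCount x =
      -(O.adjoinDiff h' (O.leftDeriv h x + O.upperContraction h x) +
        (O.leftDeriv h' (O.adjoinDiff h x) + O.upperContraction h' (O.adjoinDiff h x))) := by
  rw [stringCount, LinearMap.add_apply, upperCount_apply h h', map_add, adjoinDiff_leftDeriv]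
  abel

/-- Any operator of the form `-(dh + hd)` commutes with `d`, as both composites equal `-dhd`. -/
theorem stringCount_adjoinDiff {n : ℕ} {p q : ZMod 2} (h : p + 1 = q)
    (x : O.toSuperOperad.adjoin.Op n p) :
    O.stringCount (O.adjoinDiff h x) = O.adjoinDiff h (O.stringCount x) := by
  have h' : q + 1 = p := by rw [← h, parity_add_one_add_one]
  rw [stringCount_apply h' h, stringCount_apply h h']
  simp only [map_neg, map_add, adjoinDiff_adjoinDiff, map_zero, add_zero, zero_add]

theorem aeval_stringCount_adjoinDiff (f : k[X]) {n : ℕ} {p q : ZMod 2} (h : p + 1 = q)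
    (x : O.toSuperOperad.adjoin.Op n p) :
    aeval (O.stringCount : Module.End k (O.toSuperOperad.adjoin.Op n q)) f (O.adjoinDiff h x) =
      O.adjoinDiff h
        (aeval (O.stringCount : Module.End k (O.toSuperOperad.adjoin.Op n p)) f x) := by
  induction f using Polynomial.induction_on' with
  | add f g hf hg => simp only [map_add, LinearMap.add_apply, hf, hg]
  | monomial j r =>
    simp only [aeval_monomial, Module.End.mul_apply, Module.algebraMap_end_apply, map_smul]
    congr 1
    induction j with
    | zero => rfl
    | succ j ih =>
      rw [pow_succ', pow_succ', Module.End.mul_apply, Module.End.mul_apply, ih,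
        stringCount_adjoinDiff]

/-- A common eigenvector of `upperCount`, of the left projection and of the right projections. -/
structure IsStringTree {n : ℕ} {p : ZMod 2} (x : O.toSuperOperad.adjoin.Op n p) (e l : ℕ) :
    Prop where
  upperCount : O.upperCount x = (e : k) • x
  leftProj : O.leftProj x = (l : k) • x
  rightProj : ∀ i, O.rightProj i x = 0 ∨ O.rightProj i x = x

theorem isStringTree_of {n : ℕ} {p : ZMod 2} (x : O.Op n p) : IsStringTree (O.adjoinOf x) 0 0 where
  upperCount := by rw [upperCount_of, Nat.cast_zero, zero_smul]
  leftProj := by rw [leftProj_of, Nat.cast_zero, zero_smul]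
  rightProj i := .inl (rightProj_of i x)

theorem isStringTree_gen : IsStringTree O.adjoinGen 0 1 where
  upperCount := by rw [upperCount_gen, Nat.cast_zero, zero_smul]
  leftProj := by rw [leftProj_gen, Nat.cast_one, one_smul]
  rightProj i := .inr (rightProj_gen i)

theorem IsStringTree.act {n : ℕ} {p : ZMod 2} {x : O.toSuperOperad.adjoin.Op n p} {e l : ℕ}
    (hx : IsStringTree x e l) (σ : Equiv.Perm (Fin n)) :
    IsStringTree (O.toSuperOperad.adjoin.act σ x) e l where
  upperCount := by rw [upperCount_act, hx.upperCount, map_smul]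
  leftProj := by rw [leftProj_act, hx.leftProj, map_smul]
  rightProj i := by
    obtain ⟨i, rfl⟩ := σ.surjective i
    rw [rightProj_act]
    rcases hx.rightProj i with h | h <;> simp [h]

/-- If `x` does not end with a string at `i`, the root strings of `y` become upper strings;
otherwise they merge with a string of `x` and are not counted again. -/
theorem IsStringTree.comp {a b c : ℕ} {p q s : ZMod 2} {x : O.toSuperOperad.adjoin.Op a p}
    {y : O.toSuperOperad.adjoin.Op b q} {e e' l l' : ℕ} (hx : IsStringTree x e l)
    (hy : IsStringTree y e' l') (i : Fin a) (hc : a + b = c + 1) (hs : p + q = s) :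
    IsStringTree (O.toSuperOperad.adjoin.comp i hc hs x y) (e + e' + l') l ∨
      IsStringTree (O.toSuperOperad.adjoin.comp i hc hs x y) (e + e') l := by
  have hl : O.leftProj (O.toSuperOperad.adjoin.comp i hc hs x y) =
      (l : k) • O.toSuperOperad.adjoin.comp i hc hs x y := by
    rw [leftProj_comp, hx.leftProj, map_smul, LinearMap.smul_apply]
  have hr : ∀ j, O.rightProj j (O.toSuperOperad.adjoin.comp i hc hs x y) = 0 ∨
      O.rightProj j (O.toSuperOperad.adjoin.comp i hc hs x y) =
        O.toSuperOperad.adjoin.comp i hc hs x y := by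
    intro j
    obtain ⟨j | j, rfl⟩ := (insertEquiv hc i).surjective j
    · rw [rightProj_comp_inl]
      rcases hx.rightProj j.1 with h | h <;> simp [h]
    · rw [rightProj_comp_inr]
      rcases hy.rightProj j with h | h <;> simp [h]
  have hu := upperCount_comp i hc hs x y
  rw [hx.upperCount, hy.upperCount, hy.leftProj] at hu
  rcases hx.rightProj i with h | h
  · refine .inl ⟨?_, hl, hr⟩
    rw [hu, h, sub_zero]
    simp only [map_smul, LinearMap.smul_apply, Nat.cast_add]
    module
  · refine .inr ⟨?_, hl, hr⟩
    rw [hu, h, sub_self]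
    simp only [map_smul, LinearMap.smul_apply, Nat.cast_add, map_zero, LinearMap.zero_apply]
    module

/-- The operations of `O`, and the trees with at least one string of copies of `m`. -/
def stringTrees (O : DGOperad.{u, v} k) (n : ℕ) (p : ZMod 2) :
    Set (O.toSuperOperad.adjoin.Op n p) :=
  Set.range O.adjoinOf ∪ {x | ∃ e l, 0 < e + l ∧ IsStringTree x e l}

/-- Composition never lowers the number of strings of `x`, which settles the case of a positive
number in `x`. For `x` in `O` all the strings of `y` survive. -/
theorem comp_mem_stringTrees {a b c : ℕ} {p q s : ZMod 2} (i : Fin a) (hc : a + b = c + 1)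
    (hs : p + q = s) {x : O.toSuperOperad.adjoin.Op a p} {y : O.toSuperOperad.adjoin.Op b q}
    (hx : x ∈ O.stringTrees a p) (hy : y ∈ O.stringTrees b q) :
    O.toSuperOperad.adjoin.comp i hc hs x y ∈ O.stringTrees c s := by
  rcases hx with ⟨x, rfl⟩ | ⟨e, l, h, hx⟩
  · rcases hy with ⟨y, rfl⟩ | ⟨e', l', h', hy⟩
    · exact .inl ⟨O.comp i hc hs x y, adjoinOf_comp i hc hs x y⟩
    -- `IsStringTree.comp` alone would not do: its second alternative could give the count `0`. Here
    -- the first one is known to occur.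
    · have hp : O.rightProj i (O.adjoinOf x) = 0 := rightProj_of i x
      have hu := upperCount_comp i hc hs (O.adjoinOf x) y
      rw [hp, sub_zero, upperCount_of, hy.upperCount, hy.leftProj] at hu
      refine .inr ⟨e' + l', 0, h', ?_, ?_, ?_⟩
      · rw [hu]
        simp only [map_smul, map_zero, LinearMap.zero_apply, Nat.cast_add]
        module
      · rw [leftProj_comp, leftProj_of, map_zero, LinearMap.zero_apply, Nat.cast_zero, zero_smul]
      · rcases (isStringTree_of x).comp hy i hc hs with h | h <;> exact h.rightProj
  · obtain ⟨e', l', hy⟩ : ∃ e' l', IsStringTree y e' l' := by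
      rcases hy with ⟨y, rfl⟩ | ⟨e', l', -, hy⟩
      exacts [⟨0, 0, isStringTree_of y⟩, ⟨e', l', hy⟩]
    rcases hx.comp hy i hc hs with h' | h'
    · exact .inr ⟨_, _, by omega, h'⟩
    · exact .inr ⟨_, _, by omega, h'⟩

theorem mem_span_stringTrees {n : ℕ} {p : ZMod 2} (x : O.toSuperOperad.adjoin.Op n p) :
    x ∈ Submodule.span k (O.stringTrees n p) := by
  induction x using adjoin_induction with
  | of x => exact Submodule.subset_span (.inl ⟨x, rfl⟩)
  | gen => exact Submodule.subset_span (.inr ⟨0, 1, by decide, isStringTree_gen⟩)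
  | zero => exact Submodule.zero_mem _
  | add x y hx hy => exact Submodule.add_mem _ hx hy
  | smul r x hx => exact Submodule.smul_mem _ r hx
  | @act n p σ x hx =>
    refine Submodule.span_le (p := (Submodule.span k (O.stringTrees n p)).comap
      (O.toSuperOperad.adjoin.act σ)).2 ?_ hx
    rintro _ (⟨x, rfl⟩ | ⟨e, l, h, hx⟩)
    · exact Submodule.subset_span (.inl ⟨O.act σ x, adjoinOf_act σ x⟩)
    · exact Submodule.subset_span (.inr ⟨e, l, h, hx.act σ⟩)
  | comp i hc hs x y hx hy =>
    exact LinearMap.BilinMap.apply_apply_mem_of_mem_span _ _ _ _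
      (fun x hx y hy => Submodule.subset_span (comp_mem_stringTrees i hc hs hx hy)) x y hx hy

theorem aeval_stringCount_of (f : k[X]) {n : ℕ} {p : ZMod 2} (x : O.Op n p) :
    aeval (O.stringCount : Module.End k (O.toSuperOperad.adjoin.Op n p)) f (O.adjoinOf x) =
      f.eval 0 • O.adjoinOf x := by
  obtain ⟨g, hg⟩ : X ∣ f - C (f.eval 0) := by
    rw [X_dvd_iff, coeff_zero_eq_eval_zero]; simp
  rw [sub_eq_iff_eq_add.1 hg, mul_comm]
  simp [stringCount_of]

/-- A polynomial in the number of strings that kills the finitely many positive eigenvalues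
occurring in `x` and is `1` at `0` leaves only the part in `O`. -/
theorem exists_aeval_stringCount_eq [CharZero k] {n : ℕ} {p : ZMod 2}
    (x : O.toSuperOperad.adjoin.Op n p) :
    ∃ (f : k[X]) (y : O.Op n p), f.eval 0 = 1 ∧
      aeval (O.stringCount : Module.End k (O.toSuperOperad.adjoin.Op n p)) f x = O.adjoinOf y := by
  induction mem_span_stringTrees x using Submodule.span_induction with
  | mem x hx =>
    rcases hx with ⟨x, rfl⟩ | ⟨e, l, h, hx⟩
    · exact ⟨1, x, by simp, by simp⟩
    · have h₀ : ((e + l : ℕ) : k) ≠ 0 := Nat.cast_ne_zero.2 h.ne'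
      have h₁ : O.stringCount x = ((e + l : ℕ) : k) • x := by
        rw [stringCount, LinearMap.add_apply, hx.upperCount, hx.leftProj, Nat.cast_add, add_smul]
      -- The linear polynomial with root `e + l` and value `1` at `0`.
      refine ⟨1 - C ((e + l : ℕ) : k)⁻¹ * X, 0, by simp, ?_⟩
      simp [h₁, smul_smul, mul_inv_cancel₀ h₀, -Nat.cast_add]
  | zero => exact ⟨1, 0, by simp, by simp⟩
  | add x x' _ _ hx hx' =>
    obtain ⟨f, y, hf, hy⟩ := hx
    obtain ⟨f', y', hf', hy'⟩ := hx'
    -- On each summand its own factor is applied first and lands in `O`, where the other factor acts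
    -- by its value `1` at `0`.
    refine ⟨f * f', y + y', by simp [hf, hf'], ?_⟩
    rw [map_add, map_add]
    nth_rewrite 1 [mul_comm]
    rw [map_mul, map_mul, Module.End.mul_apply, Module.End.mul_apply, hy, hy',
      aeval_stringCount_of, aeval_stringCount_of, hf, hf', one_smul,
      one_smul]
  | smul r x _ hx =>
    obtain ⟨f, y, hf, hy⟩ := hx
    exact ⟨f, r • y, hf, by rw [map_smul, map_smul, hy]⟩

/-- A cycle of `O[m]` is homologous to a cycle of `O`. -/
theorem exists_adjoinOf_add_adjoinDiff_eq [CharZero k] {n : ℕ} {p q : ZMod 2} (h : p + 1 = q)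
    (h' : q + 1 = p) (x : O.toSuperOperad.adjoin.Op n p) (hx : O.adjoinDiff h x = 0) :
    ∃ (y : O.Op n p) (z : O.toSuperOperad.adjoin.Op n q),
      O.d h y = 0 ∧ x = O.adjoinOf y + O.adjoinDiff h' z := by
  obtain ⟨f, y, hf, hy⟩ := exists_aeval_stringCount_eq x
  -- Write `f = 1 + X g`. On a cycle `N x = -d(h x)`, so `f(N) x = x - d(g(N) h x)`, and `f(N) x`
  -- lies in `O`.
  obtain ⟨g, hg⟩ : X ∣ f - C 1 := by
    rw [X_dvd_iff, coeff_zero_eq_eval_zero]; simp [hf]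
  have hc : O.stringCount x =
      -O.adjoinDiff h' (O.leftDeriv h x + O.upperContraction h x) := by
    rw [stringCount_apply h h', hx, map_zero, map_zero, add_zero, add_zero]
  rw [sub_eq_iff_eq_add.1 hg, mul_comm, map_add, LinearMap.add_apply, map_mul, Module.End.mul_apply,
    aeval_X, hc, map_neg, aeval_stringCount_adjoinDiff, map_one, map_one,
    Module.End.one_apply] at hy
  have e := eq_add_of_neg_add_eq hy
  refine ⟨y, _, ?_, e.trans (add_comm _ _)⟩
  -- Thus `d y` vanishes in `O[m]`, and the retraction brings this back to `O`.
  have e' := congrArg (O.adjoinDiff h) e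
  rw [hx, map_add, adjoinDiff_adjoinDiff, zero_add, adjoinDiff_of] at e'
  exact (congrArg O.adjoinRetract e').symm.trans (map_zero _)

/-! ### The homology of `O[m]` and of its twisting -/

/-- Removing an `m` after adding one at the root gives `x`, and adding one after removing one gives
`leftProj x`. The right multiplications cancel, since removal at the root commutes with composition
at the inputs while the sign of `δ_m` changes with the parity. The two corrections for the missing
unit cancel each other. -/
theorem leftDeriv_inner {n : ℕ} {p q : ZMod 2} (h : p + 1 = q) (h' : q + 1 = p) (e : 1 + p = q)
    (e' : 1 + q = p) (x : O.toSuperOperad.adjoin.Op n p) :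
    O.leftDeriv h' (O.toSuperOperad.adjoin.inner e O.adjoinGen x) +
      O.toSuperOperad.adjoin.inner e' O.adjoinGen (O.leftDeriv h x) = x + O.leftProj x := by
  have hL : O.leftDeriv h' (O.toSuperOperad.adjoin.leftMul e O.adjoinGen x) = x := by
    have := leftDeriv_comp 0 (Nat.add_comm 1 n) e h' one_add_one_parity (zero_add p) O.adjoinGen x
    rw [leftDeriv_gen, genCoeff_gen, recast_self, map_zero, LinearMap.zero_apply, zero_add,
      one_smul] at this
    exact this
  have hR : O.leftDeriv h' (O.toSuperOperad.adjoin.rightMul e O.adjoinGen x) =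
      O.toSuperOperad.adjoin.rightMul e' O.adjoinGen (O.leftDeriv h x) +
        O.genCoeff x • O.toSuperOperad.adjoin.recast O.adjoinGen := by
    rw [rightMul_apply, rightMul_apply, map_sum]
    simp only [leftDeriv_comp _ rfl h h' h h']
    rw [Finset.sum_add_distrib]
    congr 1
    rcases genCoeff_eq_zero_or x with hx | ⟨rfl, rfl⟩
    · simp [hx]
    · simp
  -- Where the coefficient of `m` is nonzero, the parity is that of `m`, so the sign is `-1`.
  have hg : paritySign k p • O.genCoeff x • (O.toSuperOperad.adjoin.recast O.adjoinGen :
      O.toSuperOperad.adjoin.Op n p) =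
        -(O.genCoeff x • O.toSuperOperad.adjoin.recast O.adjoinGen) := by
    rcases genCoeff_eq_zero_or x with hx | ⟨rfl, rfl⟩
    · simp [hx]
    · rw [paritySign_one, neg_one_smul]
  have hq : paritySign k q = -paritySign k p := by
    rw [← h, paritySign_add, paritySign_one, mul_neg_one]
  rw [inner_apply, inner_apply, map_sub, map_smul, hL, hR, ← leftMul_leftDeriv h e', one_mul,
    one_mul, smul_add, hg, hq]
  module

/-- The left derivative is a contracting homotopy of the twisting of `O[m]` by `m`. -/
theorem leftDeriv_twist_d {n : ℕ} {p q : ZMod 2} (h : p + 1 = q) (h' : q + 1 = p)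
    (e : 1 + p = q) (e' : 1 + q = p) (x : O.toSuperOperad.adjoin.Op n p) :
    O.leftDeriv h' (O.adjoinDiff h x + O.toSuperOperad.adjoin.inner e O.adjoinGen x) +
      (O.adjoinDiff h' (O.leftDeriv h x) +
        O.toSuperOperad.adjoin.inner e' O.adjoinGen (O.leftDeriv h x)) = x := by
  rw [map_add, adjoinDiff_leftDeriv, ← add_right_cancel_iff (a := O.leftProj x),
    ← leftDeriv_inner h h' e e' x]
  abel

theorem hat_isAcyclic [CharZero k] (O : DGOperad.{u, v} k) : O.hat.IsAcyclic := by
  intro n p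
  refine Submodule.Quotient.subsingleton_iff.2 (eq_top_iff.2 ?_)
  rintro ⟨x, hx⟩ -
  have hx' : O.adjoinDiff (rfl : p + 1 = p + 1) x +
      O.toSuperOperad.adjoin.inner (add_comm 1 p) O.adjoinGen x = 0 := hx
  have h := leftDeriv_twist_d rfl (parity_add_one_add_one p) (add_comm 1 p)
    ((add_comm 1 (p + 1)).trans (parity_add_one_add_one p)) x
  rw [hx', map_zero, zero_add] at h
  exact ⟨_, h⟩

theorem adjoinInclusion_isInclusion (O : DGOperad.{u, v} k) : O.adjoinInclusion.IsInclusion :=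
  fun _ _ => Function.LeftInverse.injective adjoinRetract_of

/-- For injectivity, the retraction sends a primitive in `O[m]` to a primitive in `O`. Surjectivity
is the homotopy argument of `exists_adjoinOf_add_adjoinDiff_eq`. -/
theorem adjoinInclusion_isQuasiIso [CharZero k] (O : DGOperad.{u, v} k) :
    O.adjoinInclusion.IsQuasiIso := by
  intro n p
  constructor
  · rw [← LinearMap.ker_eq_bot, LinearMap.ker_eq_bot']
    intro x hx
    obtain ⟨⟨x, hx'⟩, rfl⟩ := Submodule.mkQ_surjective _ x
    obtain ⟨z, hz⟩ := (Submodule.Quotient.mk_eq_zero _).1 hx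
    refine (Submodule.Quotient.mk_eq_zero _).2 ⟨O.adjoinRetract z, ?_⟩
    exact (adjoinRetract_adjoinDiff _ z).symm.trans (congrArg O.adjoinRetract hz)
  · intro x
    obtain ⟨⟨x, hx⟩, rfl⟩ := Submodule.mkQ_surjective _ x
    change O.toSuperOperad.adjoin.Op n p at x
    obtain ⟨y, z, hy, hz⟩ :=
      exists_adjoinOf_add_adjoinDiff_eq rfl (parity_add_one_add_one p) x hx
    have h : O.adjoinDiff (parity_add_one_add_one p) (-z) = O.adjoinOf y - x := by
      rw [map_neg, eq_sub_iff_add_eq, hz, add_left_comm, neg_add_cancel, add_zero]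
    exact ⟨Submodule.mkQ _ ⟨y, hy⟩, (Submodule.Quotient.eq _).2 ⟨-z, h⟩⟩

end DGOperad

theorem theorem5p6 {k : Type u} [Field k] [CharZero k] (O : DGOperad.{u, v} k) :
    (O.adjoinInclusion.IsInclusion ∧ O.adjoinInclusion.IsQuasiIso) ∧ O.hat.IsAcyclic :=
  ⟨⟨O.adjoinInclusion_isInclusion, O.adjoinInclusion_isQuasiIso⟩, O.hat_isAcyclic⟩
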